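/- Let $r\ge 1$ be an integer, $p=r+1$ and $N=2r+1$. For $0<R<\overline R$ let $\lambda_k(R,\overline R)$ be the $k$-th radial eigenvalue ($k\ge 1$, eigenvalues in increasing order) of the Dirichlet problem $$-\Delta_p u=\lambda|u|^{p-2}u\ \text{ in }\{x\in\mathbb R^N: R<|x|<\overline R\},\qquad u=0\ \text{ on the boundary},$$ that is, the $k$-th smallest real $\lambda$ for which this problem has a nontrivial radial classical solution ($u$ continuous on the closed annulus, $u$ and the field $|\nabla u|^{p-2}\nabla u$ differentiable in the open annulus). Let $$q_{R,\overline R}(t)=\Big(\frac{p-1}{N-p}\Big)^{p}\frac{A^{(p-1)p/(N-p)}}{(B-t)^{p(N-1)/(N-p)}},\quad A=\frac{(R\overline R)^{\frac{N-p}{p-1}}}{\overline R^{\frac{N-p}{p-1}}-R^{\frac{N-p}{p-1}}},\quad B=\frac{\overline R^{\frac{N-p}{p-1}}}{\overline R^{\frac{N-p}{p-1}}-R^{\frac{N-p}{p-1}}},$$ $$\bar q_+(R,\overline R)=\int_0^1\max\{1,q_{R,\overline R}(t)\}\,dt,\qquad \bar q_-(R,\overline R)=\int_0^1\min\{1,q_{R,\overline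 R}(t)\}\,dt,\qquad \pi_p=\frac{2\pi(p-1)^{1/p}}{p\sin(\pi/p)}.$$ Then: 1. For all $R>0$ and $t\in[0,1]$, $\displaystyle q_{R,R+1}(t)=\frac{(R^2+R)^{r+1}}{(R+1-t)^{2(r+1)}}$. 2. $\displaystyle\lim_{R\to+\infty}\bar q_+(R,R+1)=\lim_{R\to+\infty}\bar q_-(R,R+1)=1$. 3. For all $R>0$ the radial eigenvalues above, with $\overline R=R+1$, are exactly the eigenvalues of $$(s^{N-1}|u'|^{p-2}u')'+\lambda s^{N-1}|u|^{p-2}u=0\ \text{ in }(R,R+1),\quad u(R)=u(R+1)=0,$$ and exactly the eigenvalues of $$(|v'|^{p-2}v')'+\lambda\,q_{R,R+1}(t)|v|^{p-2}v=0\ \text{ in }(0,1),\quad v(0)=v(1)=0$$ (in both cases with nontrivial classical solutions). 4. For every $k\ge1$, $\lambda_k(R,R+1)$ exists for all $R>0$, and $$\lim_{R\to+\infty}\lambda_k(R,R+1)=(k\pi_p)^p=(k\pi_{r+1})^{r+1}.$$ -/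

import Mathlib

open Filter Topology Set

noncomputable section

namespace RadialPLaplace

/-- The odd power `|x|^(p-2) x`. -/
def signedPow (p x : ℝ) : ℝ := |x| ^ (p - 2) * x

/-! ### Eigenvalues of one-dimensional Dirichlet problems -/

/-- `u` is a nontrivial classical solution of
`(ρ |u'|^(p-2) u')' + lam * w * |u|^(p-2) u = 0` in `(a, b)`, `u a = u b = 0`:
it is continuous on `[a, b]` and differentiable in `(a, b)`, the flux `ρ |u'|^(p-2) u'` is
differentiable in `(a, b)`, and the equation holds at every point of `(a, b)`. -/
structure IsDirichletEigenfunction (p : ℝ) (ρ w : ℝ → ℝ) (a b lam : ℝ) (u : ℝ → ℝ) : Prop where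
  continuousOn : ContinuousOn u (Icc a b)
  differentiableAt : ∀ t ∈ Ioo a b, DifferentiableAt ℝ u t
  differentiableAt_flux : ∀ t ∈ Ioo a b,
    DifferentiableAt ℝ (fun s => ρ s * signedPow p (deriv u s)) t
  equation : ∀ t ∈ Ioo a b,
    deriv (fun s => ρ s * signedPow p (deriv u s)) t + lam * w t * signedPow p (u t) = 0
  left_eq_zero : u a = 0
  right_eq_zero : u b = 0
  nontrivial : ∃ t ∈ Ioo a b, u t ≠ 0

/-- The eigenvalues of the problem of `IsDirichletEigenfunction`. -/
def dirichletEigenvalues (p : ℝ) (ρ w : ℝ → ℝ) (a b : ℝ) : Set ℝ :=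
  {lam | ∃ u : ℝ → ℝ, IsDirichletEigenfunction p ρ w a b lam u}

/-- The eigenvalues of `(s^(N-1) |u'|^(p-2) u')' + lam s^(N-1) |u|^(p-2) u = 0` in `(R, R')`,
`u(R) = u(R') = 0`. -/
def radialODEEigenvalues (N : ℕ) (p R R' : ℝ) : Set ℝ :=
  dirichletEigenvalues p (fun s => s ^ (N - 1)) (fun s => s ^ (N - 1)) R R'

/-- The eigenvalues of `(|v'|^(p-2) v')' + lam q(t) |v|^(p-2) v = 0` in `(0, 1)`,
`v(0) = v(1) = 0`. -/
def weightedEigenvalues (p : ℝ) (q : ℝ → ℝ) : Set ℝ :=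
  dirichletEigenvalues p (fun _ => 1) q 0 1

/-! ### Radial eigenvalues of the Dirichlet `p`-Laplacian on an annulus -/

/-- The divergence of a vector field on `ℝ^N`. -/
def divergence {N : ℕ} (F : EuclideanSpace ℝ (Fin N) → EuclideanSpace ℝ (Fin N))
    (x : EuclideanSpace ℝ (Fin N)) : ℝ :=
  ∑ i : Fin N, (fderiv ℝ F x (EuclideanSpace.single i 1)) i

/-- The flux `|∇u|^(p-2) ∇u` of the `p`-Laplacian. -/
def pFlux {N : ℕ} (p : ℝ) (u : EuclideanSpace ℝ (Fin N) → ℝ) (x : EuclideanSpace ℝ (Fin N)) :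
    EuclideanSpace ℝ (Fin N) :=
  ‖gradient u x‖ ^ (p - 2) • gradient u x

/-- `u` is a nontrivial radial classical solution of `-Δ_p u = lam |u|^(p-2) u` in the annulus
`{R < |x| < R'}` of `ℝ^N`, `u = 0` on its boundary. -/
structure IsRadialEigenfunction (N : ℕ) (p R R' lam : ℝ)
    (u : EuclideanSpace ℝ (Fin N) → ℝ) : Prop where
  radial : ∀ x y : EuclideanSpace ℝ (Fin N), ‖x‖ ∈ Icc R R' → ‖x‖ = ‖y‖ → u x = u y
  continuousOn : ContinuousOn u {x | ‖x‖ ∈ Icc R R'}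
  differentiableAt : ∀ x, ‖x‖ ∈ Ioo R R' → DifferentiableAt ℝ u x
  differentiableAt_flux : ∀ x, ‖x‖ ∈ Ioo R R' → DifferentiableAt ℝ (pFlux p u) x
  equation : ∀ x, ‖x‖ ∈ Ioo R R' → -divergence (pFlux p u) x = lam * signedPow p (u x)
  boundary : ∀ x, ‖x‖ = R ∨ ‖x‖ = R' → u x = 0
  nontrivial : ∃ x, ‖x‖ ∈ Ioo R R' ∧ u x ≠ 0

/-- The radial eigenvalues of the Dirichlet `p`-Laplacian on `{x ∈ ℝ^N : R < |x| < R'}`. -/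
def radialEigenvalues (N : ℕ) (p R R' : ℝ) : Set ℝ :=
  {lam | ∃ u : EuclideanSpace ℝ (Fin N) → ℝ, IsRadialEigenfunction N p R R' lam u}

/-! ### The `k`-th element of a set of eigenvalues -/

/-- `lam` is the `k`-th smallest element of `E` (counted from `k = 1`): it belongs to `E`, and
exactly `k` elements of `E` are at most `lam`. -/
def IsKthEigenvalue (E : Set ℝ) (k : ℕ) (lam : ℝ) : Prop :=
  lam ∈ E ∧ {μ | μ ∈ E ∧ μ ≤ lam}.encard = k

theorem IsKthEigenvalue.unique {E : Set ℝ} {k : ℕ} {x y : ℝ}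
    (hx : IsKthEigenvalue E k x) (hy : IsKthEigenvalue E k y) : x = y := by
  have key : ∀ {a b : ℝ}, IsKthEigenvalue E k a → IsKthEigenvalue E k b → ¬ a < b := by
    intro a b ha hb hab
    have hsub : {μ | μ ∈ E ∧ μ ≤ a} ⊂ {μ | μ ∈ E ∧ μ ≤ b} := by
      refine ⟨fun μ hμ => ⟨hμ.1, hμ.2.trans hab.le⟩, fun h => ?_⟩
      exact absurd (h ⟨hb.1, le_rfl⟩ : b ∈ E ∧ b ≤ a).2 (not_le.2 hab)
    have hfin : {μ | μ ∈ E ∧ μ ≤ a}.Finite := by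
      apply Set.finite_of_encard_eq_coe ha.2
    have := hfin.encard_lt_encard hsub
    rw [ha.2, hb.2] at this
    exact lt_irrefl _ this
  exact le_antisymm (not_lt.1 (key hy hx)) (not_lt.1 (key hx hy))

/-- The `k`-th smallest element of `E`, when there is one. -/
def kthEigenvalue (E : Set ℝ) (k : ℕ) : ℝ := sInf {lam | IsKthEigenvalue E k lam}

theorem IsKthEigenvalue.kthEigenvalue_eq {E : Set ℝ} {k : ℕ} {x : ℝ}
    (hx : IsKthEigenvalue E k x) : kthEigenvalue E k = x := by
  have : {lam | IsKthEigenvalue E k lam} = {x} :=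
    Set.ext fun y => ⟨fun hy => hy.unique hx, fun hy => by rw [hy]; exact hx⟩
  rw [kthEigenvalue, this, csInf_singleton]

/-! ### The weight of the transformed problem, in the case `p < N` -/

/-- `A = (R R')^((N-p)/(p-1)) / (R'^((N-p)/(p-1)) - R^((N-p)/(p-1)))`. -/
def coeffA (N : ℕ) (p R R' : ℝ) : ℝ :=
  (R * R') ^ ((N - p) / (p - 1)) / (R' ^ ((N - p) / (p - 1)) - R ^ ((N - p) / (p - 1)))

/-- `B = R'^((N-p)/(p-1)) / (R'^((N-p)/(p-1)) - R^((N-p)/(p-1)))`. -/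
def coeffB (N : ℕ) (p R R' : ℝ) : ℝ :=
  R' ^ ((N - p) / (p - 1)) / (R' ^ ((N - p) / (p - 1)) - R ^ ((N - p) / (p - 1)))

/-- The weight `q_{R,R'}(t)` obtained from `t = -A / s^((N-p)/(p-1)) + B`, for `1 < p < N`. -/
def weight (N : ℕ) (p R R' t : ℝ) : ℝ :=
  ((p - 1) / (N - p)) ^ p *
    (coeffA N p R R' ^ ((p - 1) * p / (N - p)) /
      (coeffB N p R R' - t) ^ (p * (N - 1) / (N - p)))

/-- `∫₀¹ min {1, q(t)} dt`. -/
def qMinus (N : ℕ) (p R R' : ℝ) : ℝ := ∫ t in (0 : ℝ)..1, min 1 (weight N p R R' t)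

/-- `∫₀¹ max {1, q(t)} dt`. -/
def qPlus (N : ℕ) (p R R' : ℝ) : ℝ := ∫ t in (0 : ℝ)..1, max 1 (weight N p R R' t)

/-- `π_p = 2 π (p-1)^(1/p) / (p sin (π/p))`. -/
def piP (p : ℝ) : ℝ :=
  2 * Real.pi * (p - 1) ^ (1 / p) / (p * Real.sin (Real.pi / p))

end RadialPLaplace

end

open RadialPLaplace

/-!
The radial problem on the annulus becomes an ordinary differential equation because a radial
function `φ(|x|)` has flux `|φ'|^(p-2) φ'(|x|) x / |x|`, whose divergence is `g' + (N-1) g / s` with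
`g = |φ'|^(p-2) φ'` (`pFlux_radial`, `divergence_radial`). The substitution
`t = R + 1 - (R² + R) / s` turns that equation into the weighted problem on `(0, 1)`
(`IsDirichletEigenfunction.comp`). On `[0, 1]` the weight lies between `(R / (R + 1))^(r+1)` and
`((R + 1) / R)^(r+1)`, so it tends to `1` uniformly as `R → ∞`.

The weighted problem is treated with a Prüfer angle. Its eigenfunctions are solutions of the system
`v' = μ |y|^(p'-2) y`, `y' = -μ q |v|^(p-2) v`, where `λ = μ^p` and `p'` is the conjugate exponent.
In the coordinates `v = ρ sin θ`, `y = ρ^(p-1) cos θ`, with the ordinary sine and cosine, the angle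
solves an equation `θ' = μ (a(θ) + q b(θ))` whose right-hand side is continuously differentiable in
`θ`, although the system itself is not Lipschitz. Hence the angle with `θ(0) = 0` exists, and its
value at time `1` is continuous and strictly increasing in `μ`.

To see that `μ^p` is an eigenvalue exactly when `θ(1)` is a multiple of `π`, an arbitrary
eigenfunction has to be compared with the solution given by the angle. This uses that solutions are
determined by their direction at one time (`IsHalfLinearSol.proportional`): wherever `y` does not
vanish the direction is given by `v / |y|^(p'-2) y`, which solves a Riccati equation with locally
Lipschitz right-hand side, and where `y` vanishes the two unknowns exchange their roles.

Finally, in the angular variable `pruferTime` the angle moves with speed between `μ min {1, q}` and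
`μ max {1, q}`, and a half turn has length `π_p`, by a substitution that leads to the Beta integral
(`pruferTime_pi`). So if `m ≤ q ≤ M` with `m ≤ 1 ≤ M`, the `k`-th eigenvalue `μ_k^p` satisfies
`k π_p / M ≤ μ_k ≤ k π_p / m`, and the bounds converge to `k π_p`.
-/

noncomputable section

namespace RadialPLaplace

/-! ### The odd power -/

theorem signedPow_zero (p : ℝ) : signedPow p 0 = 0 := by simp [signedPow]

theorem signedPow_mul (p x y : ℝ) : signedPow p (x * y) = signedPow p x * signedPow p y := by
  simp only [signedPow, abs_mul, Real.mul_rpow (abs_nonneg x) (abs_nonneg y)]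
  ring

theorem signedPow_of_pos (p : ℝ) {x : ℝ} (hx : 0 < x) : signedPow p x = x ^ (p - 1) := by
  rw [signedPow, abs_of_pos hx, ← Real.rpow_add_one hx.ne']
  congr 1
  ring

theorem signedPow_eq_zero_iff {p x : ℝ} : signedPow p x = 0 ↔ x = 0 := by
  refine ⟨fun h => ?_, fun h => by rw [h, signedPow_zero]⟩
  by_contra hx
  exact mul_ne_zero (Real.rpow_pos_of_pos (abs_pos.2 hx) _).ne' hx h

theorem mul_signedPow {p : ℝ} (hp : p ≠ 0) (x : ℝ) : x * signedPow p x = |x| ^ p := by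
  rcases eq_or_ne x 0 with rfl | hx
  · simp [signedPow, Real.zero_rpow hp]
  · have h : x * signedPow p x = |x| ^ (p - 2) * |x| ^ (2 : ℝ) := by
      rw [Real.rpow_two, sq_abs, signedPow]
      ring
    rw [h, ← Real.rpow_add (abs_pos.2 hx)]
    congr 1
    ring

theorem abs_signedPow {p : ℝ} (hp : p ≠ 1) (x : ℝ) : |signedPow p x| = |x| ^ (p - 1) := by
  rcases eq_or_ne x 0 with rfl | hx
  · simp [signedPow, Real.zero_rpow (sub_ne_zero.2 hp)]
  · rw [signedPow, abs_mul, abs_of_nonneg (Real.rpow_nonneg (abs_nonneg x) _),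
      ← Real.rpow_add_one (abs_pos.2 hx).ne']
    congr 1
    ring

/-- The odd powers with conjugate exponents are inverse to each other. -/
theorem signedPow_signedPow {p q : ℝ} (h : p.HolderConjugate q) (x : ℝ) :
    signedPow q (signedPow p x) = x := by
  rcases eq_or_ne x 0 with rfl | hx
  · simp [signedPow_zero]
  · have hx' := abs_pos.2 hx
    rw [signedPow, abs_signedPow h.lt.ne', signedPow, ← Real.rpow_mul hx'.le, ← mul_assoc,
      ← Real.rpow_add hx']
    have : (p - 1) * (q - 2) + (p - 2) = 0 := by
      have := h.mul_eq_add
      linarith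
    rw [this, Real.rpow_zero, one_mul]

theorem continuous_signedPow {p : ℝ} (hp : 1 < p) : Continuous (signedPow p) := by
  have h : ContDiff ℝ 1 (fun x : ℝ => ‖x‖ ^ p) := contDiff_norm_rpow hp
  have h2 := h.continuous_deriv le_rfl
  have h3 : deriv (fun x : ℝ => ‖x‖ ^ p) = fun x => p * signedPow p x := by
    ext x
    rw [show (fun x : ℝ => ‖x‖ ^ p) = fun x => |x| ^ p from rfl, (hasDerivAt_abs_rpow x hp).deriv,
      signedPow]
    ring
  rw [h3] at h2
  have hp0 : p ≠ 0 := by linarith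
  have h4 := h2.const_mul p⁻¹
  simpa [inv_mul_cancel_left₀ hp0] using h4

theorem hasDerivAt_abs_rpow' {p : ℝ} (hp : 1 < p) (x : ℝ) :
    HasDerivAt (fun x : ℝ => |x| ^ p) (p * signedPow p x) x := by
  simpa only [signedPow, mul_assoc] using hasDerivAt_abs_rpow x hp

theorem hasDerivAt_signedPow (p : ℝ) {x : ℝ} (hx : x ≠ 0) :
    HasDerivAt (signedPow p) ((p - 1) * |x| ^ (p - 2)) x := by
  have h := ((hasDerivAt_abs hx).rpow_const (p := p - 2) (Or.inl (abs_pos.2 hx).ne')).mul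
    (hasDerivAt_id x)
  refine h.congr_deriv ?_
  have e : |x| ^ (p - 2 - 1) * |x| = |x| ^ (p - 2) := by
    rw [← Real.rpow_add_one (abs_pos.2 hx).ne']
    congr 1
    ring
  have e2 : (SignType.sign x : ℝ) * x = |x| := by
    simp
  simp only [id]
  linear_combination (p - 2) * e + (p - 2) * |x| ^ (p - 2 - 1) * e2

/-! ### The half-linear system -/

/-- The first order system `v' = α |y|^(p'-2) y`, `y' = -β |v|^(p-2) v` on `[0, 1]`. For conjugate
exponents it is `(|v'|^(p-2) v')' + β |v|^(p-2) v = 0` when `α = 1`, and `y` is the flux; it is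
invariant under exchanging the two unknowns. -/
def IsHalfLinearSol (p p' : ℝ) (α β v y : ℝ → ℝ) : Prop :=
  ∀ t ∈ Icc (0 : ℝ) 1, HasDerivAt v (α t * signedPow p' (y t)) t ∧
    HasDerivAt y (-(β t * signedPow p (v t))) t

namespace IsHalfLinearSol

variable {p p' : ℝ} {α β v y v₁ y₁ v₂ y₂ : ℝ → ℝ}

theorem swap (h : IsHalfLinearSol p p' α β v y) :
    IsHalfLinearSol p' p (fun t => -β t) (fun t => -α t) y v := fun t ht => by
  simpa using (h t ht).symm

theorem continuousOn_fst (h : IsHalfLinearSol p p' α β v y) : ContinuousOn v (Icc 0 1) :=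
  fun t ht => (h t ht).1.continuousAt.continuousWithinAt

theorem continuousOn_snd (h : IsHalfLinearSol p p' α β v y) : ContinuousOn y (Icc 0 1) :=
  fun t ht => (h t ht).2.continuousAt.continuousWithinAt

/-- The quotient `v / |y|^(p'-2) y` solves a Riccati equation where `y` does not vanish. -/
theorem hasDerivAt_riccati (hc : p.HolderConjugate p') (h : IsHalfLinearSol p p' α β v y)
    {t : ℝ} (ht : t ∈ Icc (0 : ℝ) 1) (hy : y t ≠ 0) :
    HasDerivAt (fun s => v s / signedPow p' (y s))
      (α t + β t * (p' - 1) * |v t / signedPow p' (y t)| ^ p) t := by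
  have hne : signedPow p' (y t) ≠ 0 := fun h0 => hy (signedPow_eq_zero_iff.1 h0)
  have hy' := abs_pos.2 hy
  have h1 := (h t ht).1.div ((hasDerivAt_signedPow p' hy).comp t (h t ht).2) hne
  refine h1.congr_deriv ?_
  have e0 : (p' - 1) * p = p' := by
    have := hc.mul_eq_add
    linarith
  have e1 : |signedPow p' (y t)| ^ p = |y t| ^ p' := by
    rw [abs_signedPow hc.symm.lt.ne', ← Real.rpow_mul hy'.le, e0]
  have e2 : signedPow p' (y t) ^ 2 = |y t| ^ (p' - 2) * |y t| ^ p' := by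
    rw [← mul_signedPow hc.symm.pos.ne', signedPow]
    ring
  have hpos : 0 < |y t| ^ p' := Real.rpow_pos_of_pos hy' _
  have hpos2 : 0 < |y t| ^ (p' - 2) := Real.rpow_pos_of_pos hy' _
  have e3 : |v t / signedPow p' (y t)| ^ p = |v t| ^ p / |y t| ^ p' := by
    rw [abs_div, Real.div_rpow (abs_nonneg _) (abs_nonneg _), e1]
  rw [e3, ← mul_signedPow hc.pos.ne' (v t)]
  simp only [Function.comp]
  rw [sub_div, show α t * signedPow p' (y t) * signedPow p' (y t) / signedPow p' (y t) ^ 2 = α t by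
    field_simp, e2]
  field_simp
  ring

end IsHalfLinearSol

theorem lipschitzOnWith_abs_rpow {s : ℝ} (hs : 1 < s) (M : ℝ) :
    ∃ K : NNReal, LipschitzOnWith K (fun x : ℝ => |x| ^ s) (Icc (-M) M) := by
  have hc : ContinuousOn (fun x => s * signedPow s x) (Icc (-M) M) :=
    ((continuous_signedPow hs).const_mul s).continuousOn
  obtain ⟨C, hC⟩ := isCompact_Icc.exists_bound_of_continuousOn hc
  refine ⟨C.toNNReal, (convex_Icc (-M) M).lipschitzOnWith_of_nnnorm_hasDerivWithin_le
    (fun x _ => (hasDerivAt_abs_rpow' hs x).hasDerivWithinAt) fun x hx => ?_⟩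
  exact NNReal.le_toNNReal_of_coe_le (hC x hx)

/-- Uniqueness for `z' = a + b |z|^s`, `s > 1`. -/
theorem eqOn_of_hasDerivAt_riccati {s x₀ x₁ : ℝ} (hs : 1 < s) {a b z₁ z₂ : ℝ → ℝ} {C : ℝ}
    (hb : ∀ t ∈ Icc x₀ x₁, |b t| ≤ C)
    (h₁ : ∀ t ∈ Icc x₀ x₁, HasDerivAt z₁ (a t + b t * |z₁ t| ^ s) t)
    (h₂ : ∀ t ∈ Icc x₀ x₁, HasDerivAt z₂ (a t + b t * |z₂ t| ^ s) t)
    (h₀ : z₁ x₀ = z₂ x₀) : EqOn z₁ z₂ (Icc x₀ x₁) := by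
  have c₁ : ContinuousOn z₁ (Icc x₀ x₁) := fun t ht => (h₁ t ht).continuousAt.continuousWithinAt
  have c₂ : ContinuousOn z₂ (Icc x₀ x₁) := fun t ht => (h₂ t ht).continuousAt.continuousWithinAt
  obtain ⟨M₁, hM₁⟩ := isCompact_Icc.exists_bound_of_continuousOn c₁
  obtain ⟨M₂, hM₂⟩ := isCompact_Icc.exists_bound_of_continuousOn c₂
  obtain ⟨K, hK⟩ := lipschitzOnWith_abs_rpow hs (max M₁ M₂)
  have m₁ : ∀ t ∈ Icc x₀ x₁, z₁ t ∈ Icc (-max M₁ M₂) (max M₁ M₂) := fun t ht =>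
    abs_le.1 ((hM₁ t ht).trans (le_max_left _ _))
  have m₂ : ∀ t ∈ Icc x₀ x₁, z₂ t ∈ Icc (-max M₁ M₂) (max M₁ M₂) := fun t ht =>
    abs_le.1 ((hM₂ t ht).trans (le_max_right _ _))
  have key := eq_zero_of_abs_deriv_le_mul_abs_self_of_eq_zero_right (K := C * K)
    (c₁.sub c₂) (fun t ht => ((h₁ t (Ico_subset_Icc_self ht)).sub
      (h₂ t (Ico_subset_Icc_self ht))).hasDerivWithinAt) (by simp [h₀]) ?_
  · intro t ht
    exact sub_eq_zero.1 (key t ht)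
  · intro t ht
    have ht' := Ico_subset_Icc_self ht
    have hl := hK.norm_sub_le (m₁ t ht') (m₂ t ht')
    have e : a t + b t * |z₁ t| ^ s - (a t + b t * |z₂ t| ^ s) =
      b t * (|z₁ t| ^ s - |z₂ t| ^ s) := by ring
    rw [e, norm_mul, mul_assoc]
    exact mul_le_mul (hb t ht') hl (norm_nonneg _) ((abs_nonneg _).trans (hb t ht'))

namespace IsHalfLinearSol

variable {p p' : ℝ} {α β v y v₁ y₁ v₂ y₂ : ℝ → ℝ}

/-- If two solutions are proportional (in the sense of the half-linear scaling) at a time where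
`y₁` and `y₂` do not vanish, then they remain so for a while. -/
theorem eventually_proportional (hc : p.HolderConjugate p') {C : ℝ}
    (hβ : ∀ t ∈ Icc (0 : ℝ) 1, |β t| ≤ C)
    (h₁ : IsHalfLinearSol p p' α β v₁ y₁) (h₂ : IsHalfLinearSol p p' α β v₂ y₂)
    {t : ℝ} (ht : t ∈ Ico (0 : ℝ) 1) (hy₁ : y₁ t ≠ 0) (hy₂ : y₂ t ≠ 0)
    (h : y₁ t * signedPow p (v₂ t) = y₂ t * signedPow p (v₁ t)) :
    ∀ᶠ s in 𝓝[>] t, y₁ s * signedPow p (v₂ s) = y₂ s * signedPow p (v₁ s) := by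
  have ht' := Ico_subset_Icc_self ht
  have e : ∀ᶠ s in 𝓝 t, y₁ s ≠ 0 ∧ y₂ s ≠ 0 ∧ s < 1 :=
    ((h₁ t ht').2.continuousAt.eventually_ne hy₁).and
      (((h₂ t ht').2.continuousAt.eventually_ne hy₂).and (Iio_mem_nhds ht.2))
  obtain ⟨ε, hε, hball⟩ := Metric.eventually_nhds_iff.1 e
  have hin : ∀ s ∈ Icc t (t + ε / 2), y₁ s ≠ 0 ∧ y₂ s ≠ 0 ∧ s < 1 := fun s hs => by
    apply hball
    rw [Real.dist_eq, abs_of_nonneg (by linarith [hs.1])]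
    linarith [hs.2]
  have hin' : ∀ s ∈ Icc t (t + ε / 2), s ∈ Icc (0 : ℝ) 1 := fun s hs =>
    ⟨ht.1.trans hs.1, (hin s hs).2.2.le⟩
  have conv : ∀ s, y₁ s ≠ 0 → y₂ s ≠ 0 →
      (v₁ s / signedPow p' (y₁ s) = v₂ s / signedPow p' (y₂ s) ↔
        y₁ s * signedPow p (v₂ s) = y₂ s * signedPow p (v₁ s)) := fun s n₁ n₂ => by
    rw [div_eq_div_iff (fun h0 => n₁ (signedPow_eq_zero_iff.1 h0))
      (fun h0 => n₂ (signedPow_eq_zero_iff.1 h0))]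
    constructor
    · intro H
      have := congrArg (signedPow p) H
      rw [signedPow_mul, signedPow_mul, signedPow_signedPow hc.symm,
        signedPow_signedPow hc.symm] at this
      linarith
    · intro H
      have := congrArg (signedPow p') H
      rw [signedPow_mul, signedPow_mul, signedPow_signedPow hc, signedPow_signedPow hc] at this
      linarith
  have key := eqOn_of_hasDerivAt_riccati (x₀ := t) (x₁ := t + ε / 2) hc.lt
    (a := α) (b := fun s => β s * (p' - 1)) (C := C * (p' - 1))
    (z₁ := fun s => v₁ s / signedPow p' (y₁ s)) (z₂ := fun s => v₂ s / signedPow p' (y₂ s))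
    (fun s hs => by
      rw [abs_mul, abs_of_pos (sub_pos.2 hc.symm.lt)]
      exact mul_le_mul_of_nonneg_right (hβ s (hin' s hs)) (sub_pos.2 hc.symm.lt).le)
    (fun s hs => h₁.hasDerivAt_riccati hc (hin' s hs) (hin s hs).1)
    (fun s hs => h₂.hasDerivAt_riccati hc (hin' s hs) (hin s hs).2.1)
    ((conv t hy₁ hy₂).2 h)
  filter_upwards [Ioc_mem_nhdsGT (show t < t + ε / 2 by linarith)] with s hs
  have hs' := Ioc_subset_Icc_self hs
  exact (conv s (hin s hs').1 (hin s hs').2.1).1 (key hs')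

/-- Two nonvanishing solutions that are proportional (in the sense of the half-linear scaling) at
time `0` are proportional at all times. -/
theorem proportional (hc : p.HolderConjugate p') {C : ℝ}
    (hα : ∀ t ∈ Icc (0 : ℝ) 1, |α t| ≤ C) (hβ : ∀ t ∈ Icc (0 : ℝ) 1, |β t| ≤ C)
    (h₁ : IsHalfLinearSol p p' α β v₁ y₁) (h₂ : IsHalfLinearSol p p' α β v₂ y₂)
    (n₁ : ∀ t ∈ Icc (0 : ℝ) 1, v₁ t = 0 → y₁ t ≠ 0)
    (n₂ : ∀ t ∈ Icc (0 : ℝ) 1, v₂ t = 0 → y₂ t ≠ 0)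
    (h : y₁ 0 * signedPow p (v₂ 0) = y₂ 0 * signedPow p (v₁ 0)) :
    ∀ t ∈ Icc (0 : ℝ) 1, y₁ t * signedPow p (v₂ t) = y₂ t * signedPow p (v₁ t) := by
  have hcont := continuous_signedPow hc.lt
  have hcl : IsClosed ({t | y₁ t * signedPow p (v₂ t) = y₂ t * signedPow p (v₁ t)} ∩
      Icc (0 : ℝ) 1) := by
    have hd := (h₁.continuousOn_snd.mul (hcont.comp_continuousOn h₂.continuousOn_fst)).sub
      (h₂.continuousOn_snd.mul (hcont.comp_continuousOn h₁.continuousOn_fst))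
    have := hd.preimage_isClosed_of_isClosed isClosed_Icc (isClosed_singleton (x := (0 : ℝ)))
    convert this using 1
    ext t
    simp [sub_eq_zero, and_comm]
  refine fun t ht => hcl.Icc_subset_of_forall_mem_nhdsWithin h ?_ ht
  rintro t ⟨hts, ht⟩
  have ht' := Ico_subset_Icc_self ht
  have hts : y₁ t * signedPow p (v₂ t) = y₂ t * signedPow p (v₁ t) := hts
  by_cases hy : y₁ t = 0
  · -- Here both `v₁` and `v₂` do not vanish: exchange the unknowns.
    have hv₁ : v₁ t ≠ 0 := fun h0 => n₁ t ht' h0 hy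
    have hy₂ : y₂ t = 0 := by
      rw [hy, zero_mul] at hts
      exact (mul_eq_zero.1 hts.symm).resolve_right fun h0 => hv₁ (signedPow_eq_zero_iff.1 h0)
    have hv₂ : v₂ t ≠ 0 := fun h0 => n₂ t ht' h0 hy₂
    have aux : ∀ a b c d : ℝ, a * signedPow p' b = c * signedPow p' d →
        b * signedPow p a = d * signedPow p c := fun a b c d H => by
      have := congrArg (signedPow p) H
      rw [signedPow_mul, signedPow_mul, signedPow_signedPow hc.symm,
        signedPow_signedPow hc.symm] at this
      linarith
    have aux' : ∀ a b c d : ℝ, b * signedPow p a = d * signedPow p c →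
        a * signedPow p' b = c * signedPow p' d := fun a b c d H => by
      have := congrArg (signedPow p') H
      rw [signedPow_mul, signedPow_mul, signedPow_signedPow hc,
        signedPow_signedPow hc] at this
      linarith
    have := h₂.swap.eventually_proportional hc.symm (C := C) (fun s hs => by
      rw [abs_neg]; exact hα s hs) h₁.swap ht hv₂ hv₁ (aux' _ _ _ _ hts)
    filter_upwards [this] with s hs
    exact aux _ _ _ _ hs
  · have hy₂ : y₂ t ≠ 0 := fun h0 => by
      rw [h0, zero_mul] at hts
      exact n₂ t ht' (signedPow_eq_zero_iff.1 ((mul_eq_zero.1 hts).resolve_left hy)) h0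
    exact h₁.eventually_proportional hc hβ h₂ ht hy hy₂ hts

/-- A solution that vanishes together with its flux at some time vanishes identically. -/
theorem eq_zero (hc : p.HolderConjugate p') {C : ℝ}
    (hα : ∀ t ∈ Icc (0 : ℝ) 1, |α t| ≤ C) (hβ : ∀ t ∈ Icc (0 : ℝ) 1, |β t| ≤ C)
    (h : IsHalfLinearSol p p' α β v y) {t₀ : ℝ} (ht₀ : t₀ ∈ Icc (0 : ℝ) 1)
    (hv : v t₀ = 0) (hy : y t₀ = 0) : ∀ t ∈ Icc (0 : ℝ) 1, v t = 0 := by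
  -- The energy `|v|^p + (p-1) |y|^p'` satisfies `|E'| ≤ K E`.
  set E : ℝ → ℝ := fun t => |v t| ^ p + (p - 1) * |y t| ^ p' with hE
  have hp1 : 0 < p - 1 := sub_pos.2 hc.lt
  have e0 : (p - 1) * p' = p := by
    have := hc.mul_eq_add
    linarith
  have hE' : ∀ t ∈ Icc (0 : ℝ) 1, HasDerivAt E
      (p * (α t - β t) * (signedPow p (v t) * signedPow p' (y t))) t := fun t ht => by
    have h1 := ((hasDerivAt_abs_rpow' hc.lt (v t)).comp t (h t ht).1).add
      (((hasDerivAt_abs_rpow' hc.symm.lt (y t)).comp t (h t ht).2).const_mul (p - 1))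
    refine h1.congr_deriv ?_
    linear_combination (-(β t * signedPow p (v t) * signedPow p' (y t))) * e0
  have hC : 0 ≤ C := (abs_nonneg _).trans (hα t₀ ht₀)
  obtain ⟨K, hK⟩ : ∃ K : ℝ, ∀ t ∈ Icc (0 : ℝ) 1,
      |p * (α t - β t) * (signedPow p (v t) * signedPow p' (y t))| ≤ K * E t := by
    refine ⟨p * (2 * C) * (1 + (p - 1)⁻¹), fun t ht => ?_⟩
    have y1 : |signedPow p (v t) * signedPow p' (y t)| ≤ |v t| ^ p + |y t| ^ p' := by
      rw [abs_mul]
      have := Real.young_inequality_of_nonneg (abs_nonneg (signedPow p (v t)))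
        (abs_nonneg (signedPow p' (y t))) hc.symm
      refine this.trans ?_
      rw [abs_signedPow hc.lt.ne', abs_signedPow hc.symm.lt.ne', ← Real.rpow_mul (abs_nonneg _),
        ← Real.rpow_mul (abs_nonneg _), e0, show (p' - 1) * p = p' by
          have := hc.mul_eq_add
          linarith]
      exact add_le_add (div_le_self (by positivity) hc.symm.lt.le)
        (div_le_self (by positivity) hc.lt.le)
    have y2 : |v t| ^ p + |y t| ^ p' ≤ (1 + (p - 1)⁻¹) * E t := by
      have e : (1 + (p - 1)⁻¹) * E t = |v t| ^ p + |y t| ^ p' + ((p - 1) * |y t| ^ p' +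
          (p - 1)⁻¹ * |v t| ^ p) := by
        rw [hE]
        field_simp
        ring
      rw [e]
      have : 0 ≤ (p - 1) * |y t| ^ p' + (p - 1)⁻¹ * |v t| ^ p := by positivity
      linarith
    have y3 : |α t - β t| ≤ 2 * C := (abs_sub _ _).trans (by linarith [hα t ht, hβ t ht])
    rw [abs_mul, abs_mul, abs_of_pos hc.pos, mul_assoc (p * (2 * C))]
    exact mul_le_mul (mul_le_mul_of_nonneg_left y3 hc.pos.le) (y1.trans y2) (abs_nonneg _)
      (by have := hc.pos; positivity)
  have hcont : ContinuousOn E (Icc 0 1) := fun t ht => (hE' t ht).continuousAt.continuousWithinAt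
  have hexp : ∀ c t : ℝ, HasDerivAt (fun s => Real.exp (c * s)) (Real.exp (c * t) * c) t :=
    fun c t => by simpa using ((hasDerivAt_id t).const_mul c).exp
  have hmono : MonotoneOn (fun t => E t * Real.exp (K * t)) (Icc 0 1) := by
    refine monotoneOn_of_deriv_nonneg (convex_Icc 0 1) (hcont.mul (by fun_prop)) ?_ ?_ <;>
      rw [interior_Icc] <;> intro t ht
    · exact ((hE' t (Ioo_subset_Icc_self ht)).mul
        (hexp K t)).differentiableAt.differentiableWithinAt
    · rw [((hE' t (Ioo_subset_Icc_self ht)).fun_mul (hexp K t)).deriv]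
      have := (abs_le.1 (hK t (Ioo_subset_Icc_self ht))).1
      have := mul_nonneg (by linarith : 0 ≤ p * (α t - β t) * (signedPow p (v t) *
        signedPow p' (y t)) + K * E t) (Real.exp_pos (K * t)).le
      linarith
  have hanti : AntitoneOn (fun t => E t * Real.exp (-K * t)) (Icc 0 1) := by
    refine antitoneOn_of_deriv_nonpos (convex_Icc 0 1) (hcont.mul (by fun_prop)) ?_ ?_ <;>
      rw [interior_Icc] <;> intro t ht
    · exact ((hE' t (Ioo_subset_Icc_self ht)).mul
        (hexp (-K) t)).differentiableAt.differentiableWithinAt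
    · rw [((hE' t (Ioo_subset_Icc_self ht)).fun_mul (hexp (-K) t)).deriv]
      have := (abs_le.1 (hK t (Ioo_subset_Icc_self ht))).2
      have := mul_nonneg (by linarith : 0 ≤ K * E t - p * (α t - β t) * (signedPow p (v t) *
        signedPow p' (y t))) (Real.exp_pos (-K * t)).le
      linarith
  have hEt₀ : E t₀ = 0 := by
    simp only [hE, hv, hy, abs_zero, Real.zero_rpow hc.pos.ne', Real.zero_rpow hc.symm.pos.ne',
      mul_zero, add_zero]
  intro t ht
  have hEt : E t ≤ 0 := by
    rcases le_total t t₀ with hle | hle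
    · have := hmono ht ht₀ hle
      simp only [hEt₀, zero_mul] at this
      exact nonpos_of_mul_nonpos_left this (Real.exp_pos _)
    · have := hanti ht₀ ht hle
      simp only [hEt₀, zero_mul] at this
      exact nonpos_of_mul_nonpos_left this (Real.exp_pos _)
  have h1 : |v t| ^ p ≤ 0 := by
    have : 0 ≤ (p - 1) * |y t| ^ p' := by positivity
    simp only [hE] at hEt
    linarith
  by_contra hne
  exact absurd h1 (not_le.2 (Real.rpow_pos_of_pos (abs_pos.2 hne) _))

end IsHalfLinearSol

/-! ### The half-linear Prüfer angle -/

theorem hasDerivAt_integral_of_continuous {f : ℝ → ℝ} (hf : Continuous f) (a t : ℝ) :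
    HasDerivAt (fun s => ∫ x in a..s, f x) (f t) t :=
  intervalIntegral.integral_hasDerivAt_right (hf.intervalIntegrable _ _)
    (hf.stronglyMeasurableAtFilter _ _) hf.continuousAt

/-- The denominator of the Prüfer vector field: up to a power of the radius, minus the Jacobian of
`(ρ, θ) ↦ (ρ sin θ, ρ^(p-1) cos θ)`. -/
def pruferDen (p θ : ℝ) : ℝ := (p - 1) * Real.cos θ ^ 2 + Real.sin θ ^ 2

/-- The vector field of the Prüfer angle: in the coordinates `v = ρ sin θ`,
`y = ρ^(p-1) cos θ`, the system `v' = μ |y|^(p'-2) y`, `y' = -μ q |v|^(p-2) v` gives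
`θ' = μ * pruferField p p' q θ`. -/
def pruferField (p p' c θ : ℝ) : ℝ :=
  ((p - 1) * |Real.cos θ| ^ p' + c * |Real.sin θ| ^ p) / pruferDen p θ

theorem pruferDen_pos {p : ℝ} (hp : 1 < p) (θ : ℝ) : 0 < pruferDen p θ := by
  have h := Real.sin_sq_add_cos_sq θ
  rcases eq_or_ne (Real.sin θ) 0 with hs | hs
  · rw [hs] at h
    rw [pruferDen, hs]
    nlinarith
  · have := sq_pos_of_ne_zero hs
    have := mul_nonneg (sub_pos.2 hp).le (sq_nonneg (Real.cos θ))
    rw [pruferDen]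
    linarith

theorem contDiff_pruferDen (p : ℝ) : ContDiff ℝ 1 (pruferDen p) :=
  (contDiff_const.mul (Real.contDiff_cos.pow 2)).add (Real.contDiff_sin.pow 2)

theorem pruferField_pos {p p' : ℝ} (hc : p.HolderConjugate p') {c : ℝ} (h0 : 0 < c) (θ : ℝ) :
    0 < pruferField p p' c θ := by
  have hp1 := sub_pos.2 hc.lt
  refine div_pos ?_ (pruferDen_pos hc.lt θ)
  rcases eq_or_ne (Real.sin θ) 0 with hs | hs
  · have hcos : Real.cos θ ≠ 0 := fun h => by
      have := Real.sin_sq_add_cos_sq θ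
      simp [hs, h] at this
    have := Real.rpow_pos_of_pos (abs_pos.2 hcos) p'
    positivity
  · have := Real.rpow_pos_of_pos (abs_pos.2 hs) p
    positivity

theorem contDiff_pruferField {p p' : ℝ} (hc : p.HolderConjugate p') (c : ℝ) :
    ContDiff ℝ 1 (pruferField p p' c) := by
  have hcos : ContDiff ℝ 1 fun θ => |Real.cos θ| ^ p' :=
    (contDiff_norm_rpow hc.symm.lt).comp Real.contDiff_cos
  have hsin : ContDiff ℝ 1 fun θ => |Real.sin θ| ^ p :=
    (contDiff_norm_rpow hc.lt).comp Real.contDiff_sin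
  exact ((contDiff_const.mul hcos).add (contDiff_const.mul hsin)).div (contDiff_pruferDen p)
    fun θ => (pruferDen_pos hc.lt θ).ne'

theorem pruferField_periodic (p p' c : ℝ) : Function.Periodic (pruferField p p' c) Real.pi :=
  fun θ => by simp [pruferField, pruferDen]

theorem pruferField_eq_add (p p' c θ : ℝ) : pruferField p p' c θ =
    pruferField p p' 0 θ + c * (pruferField p p' 1 θ - pruferField p p' 0 θ) := by
  simp only [pruferField]
  ring

theorem lipschitzWith_const_mul {K : NNReal} {f : ℝ → ℝ} (hf : LipschitzWith K f) (c : ℝ) :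
    LipschitzWith (‖c‖₊ * K) fun x => c * f x :=
  LipschitzWith.of_dist_le_mul fun x y => by
    rw [Real.dist_eq, ← mul_sub, abs_mul, NNReal.coe_mul, mul_assoc]
    exact mul_le_mul_of_nonneg_left (hf.dist_le_mul x y) (abs_nonneg c)

theorem exists_lipschitzWith_of_periodic {f : ℝ → ℝ} (hf : ContDiff ℝ 1 f) {T : ℝ} (hT : 0 < T)
    (hper : Function.Periodic f T) :
    ∃ (K : NNReal) (L : ℝ), LipschitzWith K f ∧ ∀ x, |f x| ≤ L := by
  have hper' : Function.Periodic (deriv f) T := fun x => by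
    rw [← deriv_comp_add_const, show (fun x => f (x + T)) = f from funext hper]
  obtain ⟨C, hC⟩ :=
    (hper'.isBounded_of_continuous hT.ne' (hf.continuous_deriv le_rfl)).exists_norm_le
  obtain ⟨L, hL⟩ := (hper.isBounded_of_continuous hT.ne' hf.continuous).exists_norm_le
  refine ⟨C.toNNReal, L, lipschitzWith_of_nnnorm_deriv_le (hf.differentiable one_ne_zero)
    fun x => ?_, fun x => hL _ (mem_range_self x)⟩
  exact NNReal.le_toNNReal_of_coe_le (hC _ (mem_range_self x))

theorem exists_lipschitzWith_pruferField {p p' : ℝ} (hc : p.HolderConjugate p') (M : ℝ) :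
    ∃ K L : NNReal, ∀ c : ℝ, |c| ≤ M →
      LipschitzWith K (pruferField p p' c) ∧ ∀ θ, |pruferField p p' c θ| ≤ L := by
  obtain ⟨K₀, L₀, hK₀, hL₀⟩ := exists_lipschitzWith_of_periodic (contDiff_pruferField hc 0)
    Real.pi_pos (pruferField_periodic p p' 0)
  obtain ⟨K₁, L₁, hK₁, hL₁⟩ := exists_lipschitzWith_of_periodic (contDiff_pruferField hc 1)
    Real.pi_pos (pruferField_periodic p p' 1)
  have hL₀' : 0 ≤ L₀ := (abs_nonneg _).trans (hL₀ 0)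
  have hL₁' : 0 ≤ L₁ := (abs_nonneg _).trans (hL₁ 0)
  refine ⟨K₀ + M.toNNReal * (K₁ + K₀), ⟨L₀ + M.toNNReal * (L₁ + L₀), by positivity⟩,
    fun c hcM => ⟨?_, fun θ => ?_⟩⟩
  · have hM : |c| ≤ M.toNNReal := hcM.trans (Real.le_coe_toNNReal M)
    refine LipschitzWith.of_dist_le_mul fun x y => ?_
    have h0 := hK₀.dist_le_mul x y
    have h1 := (hK₁.sub hK₀).dist_le_mul x y
    rw [Real.dist_eq] at h0 h1 ⊢
    rw [pruferField_eq_add p p' c x, pruferField_eq_add p p' c y]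
    set a₀ := pruferField p p' 0 x
    set b₀ := pruferField p p' 0 y
    set a₁ := pruferField p p' 1 x
    set b₁ := pruferField p p' 1 y
    calc |a₀ + c * (a₁ - a₀) - (b₀ + c * (b₁ - b₀))|
        = |(a₀ - b₀) + c * ((a₁ - a₀) - (b₁ - b₀))| := by congr 1; ring
      _ ≤ |a₀ - b₀| + |c| * |(a₁ - a₀) - (b₁ - b₀)| := by
        rw [← abs_mul]; exact abs_add_le _ _
      _ ≤ K₀ * dist x y + M.toNNReal * ((K₁ + K₀ : NNReal) * dist x y) := by gcongr
      _ = _ := by push_cast; ring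
  · have hM : |c| ≤ M.toNNReal := hcM.trans (Real.le_coe_toNNReal M)
    rw [pruferField_eq_add p p' c θ]
    have h1 : |pruferField p p' 1 θ - pruferField p p' 0 θ| ≤ L₁ + L₀ :=
      (abs_sub _ _).trans (add_le_add (hL₁ θ) (hL₀ θ))
    calc _ ≤ |pruferField p p' 0 θ| + |c| * |pruferField p p' 1 θ - pruferField p p' 0 θ| := by
          rw [← abs_mul]; exact abs_add_le _ _
      _ ≤ L₀ + M.toNNReal * (L₁ + L₀) := by
          have := hL₀ θ
          gcongr

/-- `θ` is the Prüfer angle of the solution of `v' = μ |y|^(p'-2) y`, `y' = -μ q |v|^(p-2) v` on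
`[0, 1]` that starts in the direction `v = 0`, `y > 0`. -/
structure IsPruferAngle (p p' μ : ℝ) (q θ : ℝ → ℝ) : Prop where
  continuous : Continuous θ
  zero : θ 0 = 0
  hasDerivAt : ∀ t ∈ Icc (0 : ℝ) 1, HasDerivAt θ (μ * pruferField p p' (q t) (θ t)) t

/-- The Prüfer vector field is bounded and Lipschitz in the angle, so the angle exists on a fixed
interval around `[0, 1]`. -/
theorem exists_isPruferAngle {p p' : ℝ} (hc : p.HolderConjugate p') {q : ℝ → ℝ}
    (hq : Continuous q) {M : ℝ} (hM : ∀ t, |q t| ≤ M) (μ : ℝ) :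
    ∃ θ, IsPruferAngle p p' μ q θ := by
  obtain ⟨K, L, hKL⟩ := exists_lipschitzWith_pruferField hc M
  have hmem : (0 : ℝ) ∈ Icc (-1 : ℝ) 2 := ⟨by norm_num, by norm_num⟩
  have hpl : IsPicardLindelof (fun t x => μ * pruferField p p' (q t) x)
      (⟨0, hmem⟩ : Icc (-1 : ℝ) 2) 0 (‖μ‖₊ * L * 2) 0 (‖μ‖₊ * L) (‖μ‖₊ * K) := by
    refine ⟨fun t _ => ?_, fun x _ => ?_, fun t _ x _ => ?_, ?_⟩
    · exact (lipschitzWith_const_mul (hKL _ (hM t)).1 μ).lipschitzOnWith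
    · have : (fun t => μ * pruferField p p' (q t) x) = fun t =>
          μ * (pruferField p p' 0 x + q t * (pruferField p p' 1 x - pruferField p p' 0 x)) :=
        funext fun t => by rw [← pruferField_eq_add]
      rw [this]
      fun_prop
    · rw [norm_mul]
      push_cast
      exact mul_le_mul_of_nonneg_left ((hKL _ (hM t)).2 x) (norm_nonneg _)
    · push_cast
      norm_num
  obtain ⟨θ, h0, hθ⟩ := hpl.exists_eq_forall_mem_Icc_hasDerivWithinAt₀
  have hle : (-1 : ℝ) ≤ 2 := by norm_num
  have heq : ∀ t ∈ Icc (-1 : ℝ) 2, IccExtend hle ((Icc (-1 : ℝ) 2).domRestrict θ) t = θ t :=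
    fun t ht => by rw [IccExtend_of_mem _ _ ht]; rfl
  refine ⟨IccExtend hle ((Icc (-1 : ℝ) 2).domRestrict θ), ?_, ?_, fun t ht => ?_⟩
  · exact (continuousOn_iff_continuous_domRestrict.1 fun t ht =>
      (hθ t ht).continuousWithinAt).Icc_extend'
  · rw [heq 0 hmem, h0]
  · have ht' : t ∈ Icc (-1 : ℝ) 2 := ⟨by linarith [ht.1], by linarith [ht.2]⟩
    have hn : Icc (-1 : ℝ) 2 ∈ 𝓝 t := Icc_mem_nhds (by linarith [ht.1]) (by linarith [ht.2])
    rw [heq t ht']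
    refine ((hθ t ht').hasDerivAt hn).congr_of_eventuallyEq ?_
    filter_upwards [hn] with s hs using heq s hs

namespace IsPruferAngle

variable {p p' μ ν : ℝ} {q θ θ₁ θ₂ : ℝ → ℝ}

/-- The Prüfer angle comes from a solution of the half-linear system. -/
theorem exists_isHalfLinearSol (hc : p.HolderConjugate p') (hq : Continuous q)
    (h : IsPruferAngle p p' μ q θ) : ∃ ρ σ : ℝ → ℝ, (∀ t, 0 < ρ t) ∧ (∀ t, 0 < σ t) ∧
      IsHalfLinearSol p p' (fun _ => μ) (fun t => μ * q t)
        (fun t => ρ t * Real.sin (θ t)) (fun t => σ t * Real.cos (θ t)) := by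
  have hp1 := sub_pos.2 hc.lt
  -- `g` is the logarithmic derivative of the radius.
  set g : ℝ → ℝ := fun t => μ * (Real.sin (θ t) * signedPow p' (Real.cos (θ t)) -
    q t * (Real.cos (θ t) * signedPow p (Real.sin (θ t)))) / pruferDen p (θ t) with hg
  have hθ := h.continuous
  have hgc : Continuous g := by
    have c1 := (continuous_signedPow hc.lt).comp (Real.continuous_sin.comp hθ)
    have c2 := (continuous_signedPow hc.symm.lt).comp (Real.continuous_cos.comp hθ)
    have c3 := (contDiff_pruferDen p).continuous.comp hθ
    refine Continuous.div ?_ c3 fun t => (pruferDen_pos hc.lt _).ne'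
    exact continuous_const.mul (((Real.continuous_sin.comp hθ).mul c2).sub
      (hq.mul ((Real.continuous_cos.comp hθ).mul c1)))
  set I : ℝ → ℝ := fun t => ∫ s in (0 : ℝ)..t, g s with hI
  have hI' : ∀ t, HasDerivAt I (g t) t := hasDerivAt_integral_of_continuous hgc 0
  refine ⟨fun t => Real.exp (I t), fun t => Real.exp ((p - 1) * I t), fun t => Real.exp_pos _,
    fun t => Real.exp_pos _, fun t ht => ?_⟩
  have hd := pruferDen_pos hc.lt (θ t)
  have e1 : signedPow p (Real.exp (I t)) = Real.exp ((p - 1) * I t) := by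
    rw [signedPow_of_pos p (Real.exp_pos _), ← Real.exp_mul, mul_comm]
  have e2 : signedPow p' (Real.exp ((p - 1) * I t)) = Real.exp (I t) := by
    rw [← e1, signedPow_signedPow hc]
  have f1 : pruferField p p' (q t) (θ t) =
      ((p - 1) * (Real.cos (θ t) * signedPow p' (Real.cos (θ t))) +
        q t * (Real.sin (θ t) * signedPow p (Real.sin (θ t)))) / pruferDen p (θ t) := by
    rw [mul_signedPow hc.symm.pos.ne', mul_signedPow hc.pos.ne', pruferField]
  have hg1 : g t * pruferDen p (θ t) = μ * (Real.sin (θ t) * signedPow p' (Real.cos (θ t)) -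
      q t * (Real.cos (θ t) * signedPow p (Real.sin (θ t)))) := div_mul_cancel₀ _ hd.ne'
  have hf1 : pruferField p p' (q t) (θ t) * pruferDen p (θ t) =
      (p - 1) * (Real.cos (θ t) * signedPow p' (Real.cos (θ t))) +
        q t * (Real.sin (θ t) * signedPow p (Real.sin (θ t))) := by
    rw [f1]; exact div_mul_cancel₀ _ hd.ne'
  constructor
  · have := (hI' t).exp.fun_mul (h.hasDerivAt t ht).sin
    refine this.congr_deriv ?_
    rw [signedPow_mul, e2]
    apply mul_right_cancel₀ hd.ne'
    have hdd : pruferDen p (θ t) = (p - 1) * Real.cos (θ t) ^ 2 + Real.sin (θ t) ^ 2 := rfl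
    linear_combination (Real.exp (I t) * Real.sin (θ t)) * hg1 +
      (Real.exp (I t) * Real.cos (θ t) * μ) * hf1 -
      (Real.exp (I t) * μ * signedPow p' (Real.cos (θ t))) * hdd
  · have := ((hI' t).const_mul (p - 1)).exp.fun_mul (h.hasDerivAt t ht).cos
    refine this.congr_deriv ?_
    rw [signedPow_mul, e1]
    apply mul_right_cancel₀ hd.ne'
    have hdd : pruferDen p (θ t) = (p - 1) * Real.cos (θ t) ^ 2 + Real.sin (θ t) ^ 2 := rfl
    linear_combination (Real.exp ((p - 1) * I t) * (p - 1) * Real.cos (θ t)) * hg1 -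
      (Real.exp ((p - 1) * I t) * Real.sin (θ t) * μ) * hf1 +
      (Real.exp ((p - 1) * I t) * μ * q t * signedPow p (Real.sin (θ t))) * hdd

/-- The final angle is strictly increasing in `μ`. -/
theorem strictMono_end (hc : p.HolderConjugate p') (hq : ∀ t, 0 < q t)
    (h₁ : IsPruferAngle p p' μ q θ₁) (h₂ : IsPruferAngle p p' ν q θ₂) (hμν : μ < ν) :
    θ₁ 1 < θ₂ 1 := by
  have hle := image_le_of_deriv_right_lt_deriv_boundary' (a := 0) (b := 1)
    h₁.continuous.continuousOn
    (fun t ht => (h₁.hasDerivAt t (Ico_subset_Icc_self ht)).hasDerivWithinAt)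
    (by rw [h₁.zero, h₂.zero]) h₂.continuous.continuousOn
    (fun t ht => (h₂.hasDerivAt t (Ico_subset_Icc_self ht)).hasDerivWithinAt)
    (fun t _ he => by
      rw [he]
      exact mul_lt_mul_of_pos_right hμν (pruferField_pos hc (hq t) _))
  have h1 : (1 : ℝ) ∈ Icc (0 : ℝ) 1 := right_mem_Icc.2 zero_le_one
  refine lt_of_le_of_ne (hle h1) fun he => ?_
  -- If the angles met at time `1`, then `θ₂ - θ₁` would be negative just before.
  have hd := (h₂.hasDerivAt 1 h1).fun_sub (h₁.hasDerivAt 1 h1)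
  have hpos : 0 < ν * pruferField p p' (q 1) (θ₂ 1) - μ * pruferField p p' (q 1) (θ₁ 1) := by
    rw [he, ← sub_mul]
    exact mul_pos (sub_pos.2 hμν) (pruferField_pos hc (hq 1) _)
  have hs := (hasDerivAt_iff_tendsto_slope_left_right.1 hd).1
  have hev := (hs.eventually (lt_mem_nhds hpos)).and (Ioo_mem_nhdsLT (zero_lt_one (α := ℝ)))
  obtain ⟨s, hs1, hs2⟩ := hev.exists
  rw [slope_def_field, he, sub_self, sub_zero] at hs1
  have := hle (Ioo_subset_Icc_self hs2)
  exact absurd hs1 (not_lt.2 (div_nonpos_of_nonneg_of_nonpos (by linarith) (by linarith [hs2.2])))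

/-- The final angle depends continuously on `μ`. -/
theorem continuous_end (hc : p.HolderConjugate p') {M : ℝ} (hM : ∀ t, |q t| ≤ M)
    {θ : ℝ → ℝ → ℝ} (h : ∀ μ, IsPruferAngle p p' μ q (θ μ)) : Continuous fun μ => θ μ 1 := by
  obtain ⟨K, L, hKL⟩ := exists_lipschitzWith_pruferField hc M
  refine continuous_iff_continuousAt.2 fun μ₀ => ?_
  have hbound : ∀ μ, dist (θ μ 1) (θ μ₀ 1) ≤
      gronwallBound 0 (‖μ₀‖₊ * K : NNReal) (|μ - μ₀| * L) 1 := fun μ => by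
    have := dist_le_of_approx_trajectories_ODE (a := 0) (b := 1) (δ := 0)
      (v := fun t x => μ₀ * pruferField p p' (q t) x) (K := ‖μ₀‖₊ * K)
      (εf := |μ - μ₀| * L) (εg := 0)
      (fun t => lipschitzWith_const_mul (hKL _ (hM t)).1 μ₀)
      (h μ).continuous.continuousOn
      (fun t ht => ((h μ).hasDerivAt t (Ico_subset_Icc_self ht)).hasDerivWithinAt)
      (fun t _ => by
        rw [Real.dist_eq, ← sub_mul, abs_mul]
        exact mul_le_mul_of_nonneg_left ((hKL _ (hM t)).2 _) (abs_nonneg _))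
      (h μ₀).continuous.continuousOn
      (fun t ht => ((h μ₀).hasDerivAt t (Ico_subset_Icc_self ht)).hasDerivWithinAt)
      (fun t _ => by simp) (by simp [(h μ).zero, (h μ₀).zero])
      1 (right_mem_Icc.2 zero_le_one)
    simpa using this
  refine tendsto_iff_dist_tendsto_zero.2 (squeeze_zero (fun _ => dist_nonneg) hbound ?_)
  have hcont : Continuous fun μ : ℝ =>
      gronwallBound 0 (‖μ₀‖₊ * K : NNReal) (|μ - μ₀| * L) 1 :=
    (gronwallBound_continuous_ε 0 _ 1).comp (by fun_prop)
  have := hcont.tendsto μ₀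
  simpa [gronwallBound_ε0_δ0] using this

end IsPruferAngle

/-- The angle normalized so that it grows at unit speed when `μ = 1` and `q = 1`. -/
def pruferTime (p p' x : ℝ) : ℝ := ∫ θ in (0 : ℝ)..x, (pruferField p p' 1 θ)⁻¹

section pruferTime

variable {p p' : ℝ}

theorem continuous_inv_pruferField (hc : p.HolderConjugate p') :
    Continuous fun θ => (pruferField p p' 1 θ)⁻¹ :=
  (contDiff_pruferField hc 1).continuous.inv₀ fun θ => (pruferField_pos hc one_pos θ).ne'

theorem hasDerivAt_pruferTime (hc : p.HolderConjugate p') (x : ℝ) :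
    HasDerivAt (pruferTime p p') (pruferField p p' 1 x)⁻¹ x :=
  hasDerivAt_integral_of_continuous (continuous_inv_pruferField hc) 0 x

theorem strictMono_pruferTime (hc : p.HolderConjugate p') : StrictMono (pruferTime p p') :=
  strictMono_of_deriv_pos fun x => by
    rw [(hasDerivAt_pruferTime hc x).deriv]
    exact inv_pos.2 (pruferField_pos hc one_pos x)

theorem pruferTime_zero : pruferTime p p' 0 = 0 := by simp [pruferTime]

theorem pruferTime_nat_mul_pi (hc : p.HolderConjugate p') (k : ℕ) :
    pruferTime p p' (k * Real.pi) = k * pruferTime p p' Real.pi := by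
  have hper : Function.Periodic (fun θ => (pruferField p p' 1 θ)⁻¹) Real.pi := fun θ => by
    simp only [pruferField_periodic p p' 1 θ]
  have := hper.intervalIntegral_add_zsmul_eq k 0
    (fun a b => (continuous_inv_pruferField hc).intervalIntegrable _ _)
  simpa [pruferTime] using this

/-- The normalized angle moves with speed between `μ m` and `μ M`, because the Prüfer field is
affine in `q` and lies between `m` and `M` times its value for `q = 1`. -/
theorem IsPruferAngle.pruferTime_mem_Icc (hc : p.HolderConjugate p') {μ : ℝ} (hμ : 0 ≤ μ)
    {q θ : ℝ → ℝ} {m M : ℝ} (hm1 : m ≤ 1) (hM1 : 1 ≤ M) (hq : ∀ t, q t ∈ Icc m M)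
    (h : IsPruferAngle p p' μ q θ) :
    pruferTime p p' (θ 1) ∈ Icc (μ * m) (μ * M) := by
  set F : ℝ → ℝ := fun t => pruferTime p p' (θ t) with hF
  have hF' : ∀ t ∈ Icc (0 : ℝ) 1, HasDerivAt F
      ((pruferField p p' 1 (θ t))⁻¹ * (μ * pruferField p p' (q t) (θ t))) t := fun t ht =>
    (hasDerivAt_pruferTime hc (θ t)).comp t (h.hasDerivAt t ht)
  have hcont : ContinuousOn F (Icc 0 1) := fun t ht => (hF' t ht).continuousAt.continuousWithinAt
  have hdiff : DifferentiableOn ℝ F (interior (Icc 0 1)) := fun t ht =>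
    (hF' t (interior_subset ht)).differentiableAt.differentiableWithinAt
  have hlow : ∀ c x, m ≤ c → m * pruferField p p' 1 x ≤ pruferField p p' c x := fun c x hmc => by
    have hd := pruferDen_pos hc.lt x
    have hp1 := sub_pos.2 hc.lt
    rw [pruferField, pruferField, ← mul_div_assoc]
    have h1 : m * ((p - 1) * |Real.cos x| ^ p') ≤ (p - 1) * |Real.cos x| ^ p' :=
      mul_le_of_le_one_left (by positivity) hm1
    have h2 : m * |Real.sin x| ^ p ≤ c * |Real.sin x| ^ p := by gcongr
    refine div_le_div_of_nonneg_right ?_ hd.le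
    linarith
  have hupp : ∀ c x, c ≤ M → pruferField p p' c x ≤ M * pruferField p p' 1 x := fun c x hcM => by
    have hd := pruferDen_pos hc.lt x
    have hp1 := sub_pos.2 hc.lt
    rw [pruferField, pruferField, ← mul_div_assoc]
    have h1 : (p - 1) * |Real.cos x| ^ p' ≤ M * ((p - 1) * |Real.cos x| ^ p') :=
      le_mul_of_one_le_left (by positivity) hM1
    have h2 : c * |Real.sin x| ^ p ≤ M * |Real.sin x| ^ p := by gcongr
    refine div_le_div_of_nonneg_right ?_ hd.le
    linarith
  have hF0 : F 0 = 0 := by simp only [hF, h.zero, pruferTime_zero]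
  have z1 : (0 : ℝ) ∈ Icc (0 : ℝ) 1 := left_mem_Icc.2 zero_le_one
  have o1 : (1 : ℝ) ∈ Icc (0 : ℝ) 1 := right_mem_Icc.2 zero_le_one
  constructor
  · have := (convex_Icc (0 : ℝ) 1).mul_sub_le_image_sub_of_le_deriv hcont hdiff (C := μ * m)
      (fun t ht => by
        have hp := pruferField_pos hc one_pos (θ t)
        rw [(hF' t (interior_subset ht)).deriv, ← div_eq_inv_mul, le_div_iff₀ hp, mul_assoc]
        exact mul_le_mul_of_nonneg_left (hlow _ _ (hq t).1) hμ) 0 z1 1 o1 zero_le_one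
    simpa [hF0] using this
  · have := (convex_Icc (0 : ℝ) 1).image_sub_le_mul_sub_of_deriv_le hcont hdiff (C := μ * M)
      (fun t ht => by
        have hp := pruferField_pos hc one_pos (θ t)
        rw [(hF' t (interior_subset ht)).deriv, ← div_eq_inv_mul, div_le_iff₀ hp, mul_assoc]
        exact mul_le_mul_of_nonneg_left (hupp _ _ (hq t).2) hμ) 0 z1 1 o1 zero_le_one
    simpa [hF0] using this

end pruferTime

/-! ### Eigenvalues and the Prüfer angle -/

section

variable {p p' : ℝ} {q : ℝ → ℝ} {lam : ℝ}

/-- Eigenfunctions are differentiable, with differentiable flux, up to the end points: they extend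
to solutions of the half-linear system on `[0, 1]`. -/
theorem IsDirichletEigenfunction.exists_isHalfLinearSol (hc : p.HolderConjugate p')
    (hq : Continuous q) {u : ℝ → ℝ} (hu : IsDirichletEigenfunction p (fun _ => 1) q 0 1 lam u) :
    ∃ v w, IsHalfLinearSol p p' (fun _ => 1) (fun t => lam * q t) v w ∧ EqOn v u (Icc 0 1) := by
  set U : ℝ → ℝ := IccExtend (zero_le_one (α := ℝ)) ((Icc (0 : ℝ) 1).domRestrict u) with hUdef
  have hU : ∀ t ∈ Icc (0 : ℝ) 1, U t = u t := fun t ht => by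
    rw [hUdef, IccExtend_of_mem _ _ ht]; rfl
  have hUc : Continuous U := (continuousOn_iff_continuous_domRestrict.1 hu.continuousOn).Icc_extend'
  set f : ℝ → ℝ := fun t => lam * q t * signedPow p (U t) with hf
  have hfc : Continuous f := (continuous_const.mul hq).mul ((continuous_signedPow hc.lt).comp hUc)
  set w : ℝ → ℝ := fun t => 1 * signedPow p (deriv u (1 / 2)) - ∫ x in (1 / 2 : ℝ)..t, f x with hw
  have hw' : ∀ t, HasDerivAt w (-f t) t := fun t =>
    (hasDerivAt_integral_of_continuous hfc (1 / 2) t).const_sub _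
  have hwc : Continuous w := continuous_iff_continuousAt.2 fun t => (hw' t).continuousAt
  have hmid : (1 / 2 : ℝ) ∈ Ioo (0 : ℝ) 1 := ⟨by norm_num, by norm_num⟩
  have hflux : EqOn (fun s => 1 * signedPow p (deriv u s)) w (Ioo 0 1) := by
    refine isOpen_Ioo.eqOn_of_deriv_eq isPreconnected_Ioo
      (fun t ht => (hu.differentiableAt_flux t ht).differentiableWithinAt)
      (fun t _ => (hw' t).differentiableAt.differentiableWithinAt) (fun t ht => ?_) hmid
      (by simp [hw])
    have := hu.equation t ht
    rw [(hw' t).deriv, hf]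
    simp only [hU t (Ioo_subset_Icc_self ht)]
    linarith
  set g : ℝ → ℝ := fun t => signedPow p' (w t) with hg
  have hgc : Continuous g := (continuous_signedPow hc.symm.lt).comp hwc
  have hu' : ∀ t ∈ Ioo (0 : ℝ) 1, HasDerivAt u (g t) t := fun t ht => by
    have h1 := hflux ht
    simp only [one_mul] at h1
    have := (hu.differentiableAt t ht).hasDerivAt
    rwa [← signedPow_signedPow hc (deriv u t), h1] at this
  set v : ℝ → ℝ := fun t => ∫ x in (0 : ℝ)..t, g x with hv
  have hv' : ∀ t, HasDerivAt v (g t) t := hasDerivAt_integral_of_continuous hgc 0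
  have hvu : EqOn v u (Icc 0 1) := fun t ht => by
    rcases ht.1.eq_or_lt with h0 | h0
    · rw [← h0, hu.left_eq_zero]
      simp [hv]
    · obtain ⟨c, -, hcs⟩ := exists_hasDerivAt_eq_slope (fun s => v s - u s) (fun s => g s - g s) h0
        (ContinuousOn.sub (fun s _ => (hv' s).continuousAt.continuousWithinAt)
          (hu.continuousOn.mono (Icc_subset_Icc_right ht.2)))
        (fun s hs => (hv' s).sub (hu' s ⟨hs.1, hs.2.trans_le ht.2⟩))
      rw [sub_self, eq_comm, div_eq_zero_iff, hu.left_eq_zero] at hcs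
      have h1 : v 0 = 0 := by simp [hv]
      rcases hcs with h | h <;> linarith
  refine ⟨v, w, fun t ht => ⟨?_, ?_⟩, hvu⟩
  · simpa using hv' t
  · have := hw' t
    simp only [hf] at this
    rwa [hU t ht, ← hvu ht] at this

theorem IsHalfLinearSol.isDirichletEigenfunction (hc : p.HolderConjugate p') {v w : ℝ → ℝ}
    (h : IsHalfLinearSol p p' (fun _ => 1) (fun t => lam * q t) v w) (h0 : v 0 = 0) (h1 : v 1 = 0)
    (hne : ∃ t ∈ Ioo (0 : ℝ) 1, v t ≠ 0) :
    IsDirichletEigenfunction p (fun _ => 1) q 0 1 lam v := by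
  have hev : ∀ t ∈ Ioo (0 : ℝ) 1, (fun s => (1 : ℝ) * signedPow p (deriv v s)) =ᶠ[𝓝 t] w :=
    fun t ht => by
      filter_upwards [Ioo_mem_nhds ht.1 ht.2] with s hs
      rw [(h s (Ioo_subset_Icc_self hs)).1.deriv, one_mul, one_mul, signedPow_signedPow hc.symm]
  have hw : ∀ t ∈ Ioo (0 : ℝ) 1, HasDerivAt (fun s => (1 : ℝ) * signedPow p (deriv v s))
      (-(lam * q t * signedPow p (v t))) t := fun t ht =>
    (h t (Ioo_subset_Icc_self ht)).2.congr_of_eventuallyEq (hev t ht)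
  exact ⟨h.continuousOn_fst, fun t ht => (h t (Ioo_subset_Icc_self ht)).1.differentiableAt,
    fun t ht => (hw t ht).differentiableAt, fun t ht => by rw [(hw t ht).deriv]; ring,
    h0, h1, hne⟩

theorem IsDirichletEigenfunction.pos (hc : p.HolderConjugate p') (hq : Continuous q)
    (hq0 : ∀ t, 0 < q t) {u : ℝ → ℝ}
    (hu : IsDirichletEigenfunction p (fun _ => 1) q 0 1 lam u) : 0 < lam := by
  obtain ⟨v, w, hs, hvu⟩ := hu.exists_isHalfLinearSol hc hq
  by_contra hlam
  have hlam : lam ≤ 0 := not_lt.1 hlam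
  -- The product of the solution and its flux is monotone and vanishes at both ends.
  have hF : ∀ t ∈ Icc (0 : ℝ) 1, HasDerivAt (fun s => v s * w s)
      (|w t| ^ p' - lam * q t * |v t| ^ p) t := fun t ht => by
    refine ((hs t ht).1.mul (hs t ht).2).congr_deriv ?_
    rw [← mul_signedPow hc.symm.pos.ne', ← mul_signedPow hc.pos.ne']
    ring
  have hnn : ∀ t, 0 ≤ -(lam * q t * |v t| ^ p) := fun t => by
    have := mul_nonneg (mul_nonneg (neg_nonneg.2 hlam) (hq0 t).le)
      (Real.rpow_nonneg (abs_nonneg (v t)) p)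
    linarith
  have hmono : MonotoneOn (fun s => v s * w s) (Icc 0 1) := by
    refine monotoneOn_of_deriv_nonneg (convex_Icc 0 1)
      (fun t ht => (hF t ht).continuousAt.continuousWithinAt)
      (fun t ht => (hF t (interior_subset ht)).differentiableAt.differentiableWithinAt)
      fun t ht => ?_
    rw [(hF t (interior_subset ht)).deriv]
    have := Real.rpow_nonneg (abs_nonneg (w t)) p'
    linarith [hnn t]
  have hv0 : v 0 = 0 := by rw [hvu (left_mem_Icc.2 zero_le_one), hu.left_eq_zero]
  have hv1 : v 1 = 0 := by rw [hvu (right_mem_Icc.2 zero_le_one), hu.right_eq_zero]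
  have hzero : ∀ t ∈ Icc (0 : ℝ) 1, v t * w t = 0 := fun t ht => by
    have a := hmono (left_mem_Icc.2 zero_le_one) ht ht.1
    have b := hmono ht (right_mem_Icc.2 zero_le_one) ht.2
    simp only [hv0, hv1, zero_mul] at a b
    exact le_antisymm b a
  have hw : ∀ t ∈ Ioo (0 : ℝ) 1, w t = 0 := fun t ht => by
    have h1 : HasDerivAt (fun s => v s * w s) 0 t :=
      (hasDerivAt_const t (0 : ℝ)).congr_of_eventuallyEq (by
        filter_upwards [Icc_mem_nhds ht.1 ht.2] with s hs using hzero s hs)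
    have h2 := (hF t (Ioo_subset_Icc_self ht)).unique h1
    by_contra hne
    have := Real.rpow_pos_of_pos (abs_pos.2 hne) p'
    linarith [hnn t]
  obtain ⟨t, ht, hne⟩ := hu.nontrivial
  obtain ⟨c, hcm, hcs⟩ := exists_hasDerivAt_eq_slope v _ ht.1
    (hs.continuousOn_fst.mono (Icc_subset_Icc_right ht.2.le))
    (fun s hs' => (hs s ⟨hs'.1.le, (hs'.2.trans ht.2).le⟩).1)
  rw [hw c ⟨hcm.1, hcm.2.trans ht.2⟩, signedPow_zero, mul_zero, eq_comm, div_eq_zero_iff, hv0,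
    hvu (Ioo_subset_Icc_self ht)] at hcs
  rcases hcs with h | h
  · exact hne (by linarith)
  · linarith [ht.1]

/-- Rescaling the flux by `μ^(p-1)` distributes the eigenvalue `μ^p` evenly over the two equations
of the system. -/
theorem isHalfLinearSol_scale_iff (hc : p.HolderConjugate p') {μ : ℝ} (hμ : 0 < μ)
    {v y : ℝ → ℝ} :
    IsHalfLinearSol p p' (fun _ => 1) (fun t => μ ^ p * q t) v (fun t => signedPow p μ * y t) ↔
      IsHalfLinearSol p p' (fun _ => μ) (fun t => μ * q t) v y := by
  have hκ : signedPow p μ ≠ 0 := fun h => hμ.ne' (signedPow_eq_zero_iff.1 h)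
  have e : μ ^ p = signedPow p μ * μ := by
    rw [mul_comm, mul_signedPow hc.pos.ne', abs_of_pos hμ]
  refine forall₂_congr fun t _ => and_congr ?_ ?_
  · rw [signedPow_mul, signedPow_signedPow hc, one_mul]
  · constructor
    · intro h
      have := h.const_mul (signedPow p μ)⁻¹
      simp only [inv_mul_cancel_left₀ hκ] at this
      refine this.congr_deriv ?_
      rw [e]
      field_simp
    · intro h
      refine (h.const_mul (signedPow p μ)).congr_deriv ?_
      rw [e]
      ring

/-- `μ^p` is an eigenvalue if and only if the Prüfer angle at time `1` is a multiple of `π`. -/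
theorem mem_weightedEigenvalues_iff (hc : p.HolderConjugate p') (hq : Continuous q) {M : ℝ}
    (hM : ∀ t, |q t| ≤ M) {μ : ℝ} (hμ : 0 < μ) {θ : ℝ → ℝ} (hθ : IsPruferAngle p p' μ q θ) :
    μ ^ p ∈ weightedEigenvalues p q ↔ Real.sin (θ 1) = 0 := by
  obtain ⟨ρ, σ, hρ, hσ, hsol⟩ := hθ.exists_isHalfLinearSol hc hq
  have h1mem : (1 : ℝ) ∈ Icc (0 : ℝ) 1 := right_mem_Icc.2 zero_le_one
  have hne : ∀ x, Real.sin x = 0 → Real.cos x ≠ 0 := fun x hs hcos => by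
    have := Real.sin_sq_add_cos_sq x
    simp [hs, hcos] at this
  have hκ : signedPow p μ ≠ 0 := fun h => hμ.ne' (signedPow_eq_zero_iff.1 h)
  constructor
  · rintro ⟨u, hu⟩
    obtain ⟨v, w, hvw, hvu⟩ := hu.exists_isHalfLinearSol hc hq
    have hv0 : v 0 = 0 := by rw [hvu (left_mem_Icc.2 zero_le_one), hu.left_eq_zero]
    have hv1 : v 1 = 0 := by rw [hvu h1mem, hu.right_eq_zero]
    have hvy : IsHalfLinearSol p p' (fun _ => μ) (fun t => μ * q t) v
        (fun t => (signedPow p μ)⁻¹ * w t) := by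
      rw [← isHalfLinearSol_scale_iff hc hμ]
      simpa only [mul_inv_cancel_left₀ hκ] using hvw
    have hα : ∀ t ∈ Icc (0 : ℝ) 1, |(fun _ => μ) t| ≤ μ * max 1 M := fun t _ => by
      rw [abs_of_pos hμ]
      exact le_mul_of_one_le_right hμ.le (le_max_left _ _)
    have hβ : ∀ t ∈ Icc (0 : ℝ) 1, |μ * q t| ≤ μ * max 1 M := fun t _ => by
      rw [abs_mul, abs_of_pos hμ]
      exact mul_le_mul_of_nonneg_left ((hM t).trans (le_max_right _ _)) hμ.le
    have hnz : ∀ t ∈ Icc (0 : ℝ) 1, v t = 0 → (signedPow p μ)⁻¹ * w t ≠ 0 := fun t ht hvt hyt => by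
      obtain ⟨s, hs, hus⟩ := hu.nontrivial
      have hs' := Ioo_subset_Icc_self hs
      exact hus (by rw [← hvu hs', hvy.eq_zero hc hα hβ ht hvt hyt s hs'])
    have key := hvy.proportional hc hα hβ hsol hnz
      (fun t _ h0 => mul_ne_zero (hσ t).ne'
        (hne _ ((mul_eq_zero.1 h0).resolve_left (hρ t).ne')))
      (by simp [hv0, hθ.zero, signedPow_zero]) 1 h1mem
    rw [hv1, signedPow_zero, mul_zero] at key
    have := signedPow_eq_zero_iff.1 ((mul_eq_zero.1 key).resolve_left (hnz 1 h1mem hv1))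
    exact (mul_eq_zero.1 this).resolve_left (hρ 1).ne'
  · intro hsin
    refine ⟨_, ((isHalfLinearSol_scale_iff hc hμ).2 hsol).isDirichletEigenfunction hc
      (by simp [hθ.zero]) (by simp [hsin]) ?_⟩
    by_contra! hz
    have hmid : (1 / 2 : ℝ) ∈ Ioo (0 : ℝ) 1 := ⟨by norm_num, by norm_num⟩
    have h1 := (hasDerivAt_const (1 / 2 : ℝ) (0 : ℝ)).congr_of_eventuallyEq
      (f₁ := fun t => ρ t * Real.sin (θ t)) (by
        filter_upwards [Ioo_mem_nhds hmid.1 hmid.2] with s hs using hz s hs)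
    have h2 := (hsol _ (Ioo_subset_Icc_self hmid)).1.unique h1
    have h3 := signedPow_eq_zero_iff.1 ((mul_eq_zero.1 h2).resolve_left hμ.ne')
    exact hne _ ((mul_eq_zero.1 (hz _ hmid)).resolve_left (hρ _).ne')
      ((mul_eq_zero.1 h3).resolve_left (hσ _).ne')

/-- The eigenvalues of the weighted problem, with two-sided bounds, for a weight between `m ≤ 1`
and `M ≥ 1`. -/
theorem exists_weightedEigenvalues_eq_range (hc : p.HolderConjugate p') (hq : Continuous q)
    {m M : ℝ} (hm : 0 < m) (hm1 : m ≤ 1) (hM1 : 1 ≤ M) (hqmM : ∀ t, q t ∈ Icc m M) :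
    ∃ μ : ℕ → ℝ, StrictMono μ ∧
      (∀ k : ℕ, μ k ∈ Icc ((k + 1) * pruferTime p p' Real.pi / M)
        ((k + 1) * pruferTime p p' Real.pi / m)) ∧
      weightedEigenvalues p q = range fun k => μ k ^ p := by
  have hq0 : ∀ t, 0 < q t := fun t => hm.trans_le (hqmM t).1
  have hM0 : 0 < M := zero_lt_one.trans_le hM1
  have hM : ∀ t, |q t| ≤ M := fun t => by rw [abs_of_pos (hq0 t)]; exact (hqmM t).2
  choose θ hθ using exists_isPruferAngle hc hq hM
  have hmono : StrictMono fun μ => θ μ 1 := fun μ ν h =>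
    (hθ μ).strictMono_end hc hq0 (hθ ν) h
  have hcont : Continuous fun μ => θ μ 1 := IsPruferAngle.continuous_end hc hM hθ
  have hT := strictMono_pruferTime hc
  have hT0 : 0 < pruferTime p p' Real.pi := by
    have := hT Real.pi_pos
    rwa [pruferTime_zero] at this
  have hbd : ∀ μ, 0 ≤ μ → pruferTime p p' (θ μ 1) ∈ Icc (μ * m) (μ * M) := fun μ hμ =>
    (hθ μ).pruferTime_mem_Icc hc hμ hm1 hM1 hqmM
  have hex : ∀ k : ℕ, ∃ μ ∈ Icc ((k + 1) * pruferTime p p' Real.pi / M)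
      ((k + 1) * pruferTime p p' Real.pi / m), θ μ 1 = (k + 1 : ℕ) * Real.pi := fun k => by
    have hk : 0 < (k + 1) * pruferTime p p' Real.pi := by positivity
    have hval := pruferTime_nat_mul_pi hc (k + 1)
    push_cast at hval
    have hle : (k + 1) * pruferTime p p' Real.pi / M ≤ (k + 1) * pruferTime p p' Real.pi / m :=
      div_le_div_of_nonneg_left hk.le hm (hm1.trans hM1)
    refine intermediate_value_Icc hle hcont.continuousOn ⟨?_, ?_⟩
    · have := (hbd _ (div_pos hk hM0).le).2
      rw [div_mul_cancel₀ _ hM0.ne'] at this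
      push_cast
      exact hT.le_iff_le.1 (this.trans hval.ge)
    · have := (hbd _ (div_pos hk hm).le).1
      rw [div_mul_cancel₀ _ hm.ne'] at this
      push_cast
      exact hT.le_iff_le.1 (hval.le.trans this)
  choose μ hμ hθμ using hex
  have hμ0 : ∀ k, 0 < μ k := fun k =>
    lt_of_lt_of_le (by positivity) (hμ k).1
  refine ⟨μ, fun j k hjk => ?_, hμ, Subset.antisymm ?_ ?_⟩
  · rw [← hmono.lt_iff_lt]
    simp only [hθμ]
    exact mul_lt_mul_of_pos_right (by exact_mod_cast Nat.succ_lt_succ hjk) Real.pi_pos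
  · rintro lam ⟨u, hu⟩
    have hlam := hu.pos hc hq hq0
    have hν : 0 < lam ^ (p⁻¹) := Real.rpow_pos_of_pos hlam _
    have hpow : (lam ^ (p⁻¹)) ^ p = lam := Real.rpow_inv_rpow hlam.le hc.pos.ne'
    have hsin := (mem_weightedEigenvalues_iff hc hq hM hν (hθ _)).1 (by rw [hpow]; exact ⟨u, hu⟩)
    obtain ⟨n, hn⟩ := Real.sin_eq_zero_iff.1 hsin
    have hpos : 0 < θ (lam ^ p⁻¹) 1 := by
      rw [← hT.lt_iff_lt, pruferTime_zero]
      exact lt_of_lt_of_le (mul_pos hν hm) (hbd _ hν.le).1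
    have hn0 : 0 < n := by
      rw [← hn] at hpos
      exact_mod_cast (pos_iff_pos_of_mul_pos hpos).2 Real.pi_pos
    obtain ⟨k, rfl⟩ : ∃ k : ℕ, n = (k + 1 : ℕ) :=
      ⟨(n - 1).toNat, by omega⟩
    refine ⟨k, ?_⟩
    have : μ k = lam ^ p⁻¹ := hmono.injective (by simp only [hθμ, ← hn]; norm_cast)
    simp only [this, hpow]
  · rintro _ ⟨k, rfl⟩
    refine (mem_weightedEigenvalues_iff hc hq hM (hμ0 k) (hθ _)).2 ?_
    rw [hθμ]
    exact Real.sin_nat_mul_pi _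

end

theorem isKthEigenvalue_range {f : ℕ → ℝ} (hf : StrictMono f) (k : ℕ) :
    IsKthEigenvalue (range f) (k + 1) (f k) := by
  refine ⟨mem_range_self k, ?_⟩
  have : {μ | μ ∈ range f ∧ μ ≤ f k} = f '' (Finset.range (k + 1) : Set ℕ) := by
    ext x
    constructor
    · rintro ⟨⟨j, rfl⟩, hj⟩
      exact ⟨j, by simpa [Nat.lt_succ_iff] using hf.le_iff_le.1 hj, rfl⟩
    · rintro ⟨j, hj, rfl⟩
      exact ⟨mem_range_self j, hf.monotone (by simpa [Nat.lt_succ_iff] using hj)⟩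
  rw [this, hf.injective.encard_image, Set.encard_coe_eq_coe_finsetCard, Finset.card_range]

theorem IsDirichletEigenfunction.congr_weight {p a b lam : ℝ} {ρ w w' u : ℝ → ℝ}
    (h : IsDirichletEigenfunction p ρ w a b lam u) (hw : EqOn w w' (Ioo a b)) :
    IsDirichletEigenfunction p ρ w' a b lam u :=
  { h with equation := fun t ht => by rw [← hw ht]; exact h.equation t ht }

theorem weightedEigenvalues_congr {p : ℝ} {q q' : ℝ → ℝ} (h : EqOn q q' (Ioo 0 1)) :
    weightedEigenvalues p q = weightedEigenvalues p q' :=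
  Subset.antisymm (fun _ ⟨u, hu⟩ => ⟨u, hu.congr_weight h⟩)
    fun _ ⟨u, hu⟩ => ⟨u, hu.congr_weight h.symm⟩

/-! ### The half period `π_p` -/

/-- The Beta integral `B(s, 1 - s)`, evaluated by the reflection formula for the Gamma function. -/
theorem integral_rpow_mul_one_sub_rpow {s : ℝ} (h0 : 0 < s) (h1 : s < 1) :
    ∫ x in (0 : ℝ)..1, x ^ (s - 1) * (1 - x) ^ (-s) = Real.pi / Real.sin (Real.pi * s) := by
  have hs : 0 < (s : ℂ).re := by simpa using h0
  have ht : 0 < (1 - (s : ℂ)).re := by simpa using h1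
  have h := Complex.Gamma_mul_Gamma_eq_betaIntegral hs ht
  rw [Complex.Gamma_mul_Gamma_one_sub, add_sub_cancel, Complex.Gamma_one, one_mul,
    Complex.betaIntegral] at h
  have e : ∫ x in (0 : ℝ)..1, (x : ℂ) ^ ((s : ℂ) - 1) * (1 - (x : ℂ)) ^ (1 - (s : ℂ) - 1) =
      ∫ x in (0 : ℝ)..1, ((x ^ (s - 1) * (1 - x) ^ (-s) : ℝ) : ℂ) := by
    refine intervalIntegral.integral_congr fun x hx => ?_
    rw [uIcc_of_le zero_le_one] at hx
    rw [Complex.ofReal_mul, Complex.ofReal_cpow hx.1, Complex.ofReal_cpow (sub_nonneg.2 hx.2)]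
    push_cast
    congr 2
    ring
  rw [e, intervalIntegral.integral_ofReal] at h
  exact_mod_cast h.symm

section

variable {p p' : ℝ}

theorem pruferTime_pi_eq_two_mul (hc : p.HolderConjugate p') :
    pruferTime p p' Real.pi = 2 * pruferTime p p' (Real.pi / 2) := by
  have hi : ∀ a b, IntervalIntegrable (fun θ => (pruferField p p' 1 θ)⁻¹)
      MeasureTheory.volume a b := fun a b => (continuous_inv_pruferField hc).intervalIntegrable a b
  have h : ∫ θ in (Real.pi / 2)..Real.pi, (pruferField p p' 1 θ)⁻¹ =
      ∫ θ in (0 : ℝ)..(Real.pi / 2), (pruferField p p' 1 θ)⁻¹ := by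
    have := intervalIntegral.integral_comp_sub_left (a := 0) (b := Real.pi / 2)
      (fun θ => (pruferField p p' 1 θ)⁻¹) Real.pi
    rw [sub_zero, sub_half] at this
    rw [← this]
    simp [pruferField, pruferDen, Real.sin_pi_sub, Real.cos_pi_sub]
  rw [pruferTime, ← intervalIntegral.integral_add_adjacent_intervals (hi 0 (Real.pi / 2)) (hi _ _),
    h, pruferTime, two_mul]

/-- The energy fraction `|v|^p / (|v|^p + (p-1) |y|^p')` as a function of the Prüfer angle. The
substitution `u = energyFraction p p' θ` turns the half period into a Beta integral. -/
def energyFraction (p p' θ : ℝ) : ℝ :=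
  |Real.sin θ| ^ p / ((p - 1) * |Real.cos θ| ^ p' + |Real.sin θ| ^ p)

theorem energy_pos (hc : p.HolderConjugate p') (θ : ℝ) :
    0 < (p - 1) * |Real.cos θ| ^ p' + |Real.sin θ| ^ p := by
  have h := mul_pos (pruferField_pos hc one_pos θ) (pruferDen_pos hc.lt θ)
  rwa [pruferField, div_mul_cancel₀ _ (pruferDen_pos hc.lt θ).ne', one_mul] at h

theorem hasDerivAt_energyFraction (hc : p.HolderConjugate p') (θ : ℝ) :
    HasDerivAt (energyFraction p p')
      (p * (signedPow p (Real.sin θ) * signedPow p' (Real.cos θ)) * pruferDen p θ /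
        ((p - 1) * |Real.cos θ| ^ p' + |Real.sin θ| ^ p) ^ 2) θ := by
  have h1 := (hasDerivAt_abs_rpow' hc.lt (Real.sin θ)).comp θ (Real.hasDerivAt_sin θ)
  have h2 := ((hasDerivAt_abs_rpow' hc.symm.lt (Real.cos θ)).comp θ
    (Real.hasDerivAt_cos θ)).const_mul (p - 1)
  refine (h1.div (h2.add h1) (energy_pos hc θ).ne').congr_deriv ?_
  have e0 : (p - 1) * p' = p := by
    have := hc.mul_eq_add
    linarith
  simp only [Function.comp, Pi.add_apply]
  congr 1
  rw [← mul_signedPow hc.pos.ne', ← mul_signedPow hc.symm.pos.ne', pruferDen]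
  linear_combination (Real.sin θ ^ 2 * signedPow p (Real.sin θ) *
    signedPow p' (Real.cos θ)) * e0

/-- The time the Prüfer angle needs for a half turn when `μ = 1` and `q = 1` is `π_p`. -/
theorem pruferTime_pi (hc : p.HolderConjugate p') : pruferTime p p' Real.pi = piP p := by
  have hp0 := hc.pos
  have hp1 := sub_pos.2 hc.lt
  set s := Ioo 0 (Real.pi / 2) with hs
  have hsin : ∀ θ ∈ s, 0 < Real.sin θ := fun θ hθ =>
    Real.sin_pos_of_pos_of_lt_pi hθ.1 (by linarith [hθ.2, Real.pi_pos])
  have hcos : ∀ θ ∈ s, 0 < Real.cos θ := fun θ hθ =>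
    Real.cos_pos_of_mem_Ioo ⟨by linarith [hθ.1, Real.pi_pos], hθ.2⟩
  have hcont : Continuous (energyFraction p p') :=
    continuous_iff_continuousAt.2 fun θ => (hasDerivAt_energyFraction hc θ).continuousAt
  have hpos : ∀ θ ∈ s, 0 < p * (signedPow p (Real.sin θ) * signedPow p' (Real.cos θ)) *
      pruferDen p θ / ((p - 1) * |Real.cos θ| ^ p' + |Real.sin θ| ^ p) ^ 2 := fun θ hθ => by
    rw [signedPow_of_pos _ (hsin θ hθ), signedPow_of_pos _ (hcos θ hθ)]
    have h1 := Real.rpow_pos_of_pos (hsin θ hθ) (p - 1)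
    have h2 := Real.rpow_pos_of_pos (hcos θ hθ) (p' - 1)
    have h3 := pruferDen_pos hc.lt θ
    have h4 := energy_pos hc θ
    positivity
  have hinj : InjOn (energyFraction p p') s := by
    refine (strictMonoOn_of_deriv_pos (convex_Ioo _ _) hcont.continuousOn fun θ hθ => ?_).injOn
    rw [(hasDerivAt_energyFraction hc θ).deriv]
    exact hpos θ (interior_subset hθ)
  have himg : energyFraction p p' '' s = Ioo 0 1 := by
    refine Subset.antisymm ?_ ?_
    · rintro _ ⟨θ, hθ, rfl⟩
      have h1 := Real.rpow_pos_of_pos (abs_pos.2 (hsin θ hθ).ne') p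
      have h2 := Real.rpow_pos_of_pos (abs_pos.2 (hcos θ hθ).ne') p'
      have h4 := energy_pos hc θ
      refine ⟨div_pos h1 h4, (div_lt_one h4).2 ?_⟩
      have := mul_pos hp1 h2
      linarith
    · have := intermediate_value_Ioo (by positivity : (0 : ℝ) ≤ Real.pi / 2)
        hcont.continuousOn
      simpa [energyFraction, Real.zero_rpow hp0.ne', Real.zero_rpow hc.symm.pos.ne'] using this
  -- `G` is the Beta density, normalized for the substitution `u = energyFraction p p' θ`.
  set G : ℝ → ℝ := fun u => (p - 1) ^ (1 / p) / p * (u ^ (1 / p - 1) * (1 - u) ^ (-(1 / p))) with hG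
  have key := MeasureTheory.integral_image_eq_integral_abs_deriv_smul (measurableSet_Ioo)
    (fun θ _ => (hasDerivAt_energyFraction hc θ).hasDerivWithinAt) hinj G
  have hpt : ∀ θ ∈ s, |p * (signedPow p (Real.sin θ) * signedPow p' (Real.cos θ)) *
      pruferDen p θ / ((p - 1) * |Real.cos θ| ^ p' + |Real.sin θ| ^ p) ^ 2| •
        G (energyFraction p p' θ) = (pruferField p p' 1 θ)⁻¹ := fun θ hθ => by
    rw [abs_of_pos (hpos θ hθ), smul_eq_mul, signedPow_of_pos _ (hsin θ hθ),
      signedPow_of_pos _ (hcos θ hθ), hG]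
    have hn := energy_pos hc θ
    have hd := pruferDen_pos hc.lt θ
    have hsp := hsin θ hθ
    have hcp := hcos θ hθ
    have h1 : 1 - energyFraction p p' θ = (p - 1) * Real.cos θ ^ p' /
        ((p - 1) * |Real.cos θ| ^ p' + |Real.sin θ| ^ p) := by
      rw [energyFraction, one_sub_div hn.ne', add_sub_cancel_right, abs_of_pos hcp]
    simp only [h1]
    rw [energyFraction, pruferField, one_mul, inv_div]
    rw [abs_of_pos hsp, abs_of_pos hcp] at hn ⊢
    set n := (p - 1) * Real.cos θ ^ p' + Real.sin θ ^ p with hndef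
    have ep : p * (1 / p) = 1 := by field_simp
    have ep' : p' * (1 / p) = p' - 1 := by
      have := hc.mul_eq_add
      field_simp
      linarith
    have a1 : (Real.sin θ ^ p / n) ^ (1 / p - 1) =
        (Real.sin θ ^ (p - 1))⁻¹ / n ^ (1 / p - 1) := by
      rw [Real.div_rpow (by positivity) hn.le, ← Real.rpow_mul hsp.le, ← Real.rpow_neg hsp.le]
      congr 2
      linarith
    have a2 : ((p - 1) * Real.cos θ ^ p' / n) ^ (-(1 / p)) =
        ((p - 1) ^ (1 / p))⁻¹ * (Real.cos θ ^ (p' - 1))⁻¹ / n ^ (-(1 / p)) := by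
      rw [Real.div_rpow (by positivity) hn.le, Real.mul_rpow hp1.le (by positivity),
        ← Real.rpow_mul hcp.le, Real.rpow_neg hp1.le, mul_neg, ep', Real.rpow_neg hcp.le]
    have a3 : n ^ (1 / p - 1) * n ^ (-(1 / p)) = n⁻¹ := by
      rw [← Real.rpow_add hn, ← Real.rpow_neg_one]
      congr 1
      ring
    rw [a1, a2]
    have b1 := Real.rpow_pos_of_pos hsp (p - 1)
    have b2 := Real.rpow_pos_of_pos hcp (p' - 1)
    have b3 := Real.rpow_pos_of_pos hp1 (1 / p)
    calc _ = pruferDen p θ / n ^ 2 / (n ^ (1 / p - 1) * n ^ (-(1 / p))) := by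
          field_simp
      _ = pruferDen p θ / n := by
          rw [a3]
          field_simp
  rw [himg, MeasureTheory.setIntegral_congr_fun measurableSet_Ioo hpt] at key
  have hquarter : pruferTime p p' (Real.pi / 2) =
      (p - 1) ^ (1 / p) / p * (Real.pi / Real.sin (Real.pi * (1 / p))) := by
    rw [pruferTime, intervalIntegral.integral_of_le (by positivity),
      MeasureTheory.integral_Ioc_eq_integral_Ioo, ← hs, ← key,
      ← MeasureTheory.integral_Ioc_eq_integral_Ioo, ← intervalIntegral.integral_of_le zero_le_one,
      hG, intervalIntegral.integral_const_mul,
      integral_rpow_mul_one_sub_rpow (by positivity) ((div_lt_one hp0).2 hc.lt)]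
  rw [pruferTime_pi_eq_two_mul hc, hquarter, piP, mul_one_div]
  have hsp : 0 < Real.sin (Real.pi / p) :=
    Real.sin_pos_of_pos_of_lt_pi (by positivity) (div_lt_self Real.pi_pos hc.lt)
  field_simp

end

/-! ### Radial functions on an annulus -/

section

variable {N : ℕ}

theorem hasFDerivAt_norm_of_ne_zero {x : EuclideanSpace ℝ (Fin N)} (hx : x ≠ 0) :
    HasFDerivAt (fun y : EuclideanSpace ℝ (Fin N) => ‖y‖) (‖x‖⁻¹ • innerSL ℝ x) x := by
  have hn : ‖x‖ ≠ 0 := norm_ne_zero_iff.2 hx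
  have h := ((hasStrictFDerivAt_norm_sq x).hasFDerivAt).sqrt (pow_ne_zero 2 hn)
  simp only [Real.sqrt_sq (norm_nonneg _)] at h
  refine h.congr_fderiv ?_
  ext v
  simp
  field_simp

/-- The gradient of a radial function. -/
theorem hasGradientAt_radial {u : EuclideanSpace ℝ (Fin N) → ℝ} {φ : ℝ → ℝ} {c : ℝ}
    {x : EuclideanSpace ℝ (Fin N)} (hx : x ≠ 0) (hφ : HasDerivAt φ c ‖x‖)
    (hu : u =ᶠ[𝓝 x] fun y => φ ‖y‖) : HasGradientAt u ((c / ‖x‖) • x) x := by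
  rw [hasGradientAt_iff_hasFDerivAt]
  refine ((hφ.comp_hasFDerivAt x (hasFDerivAt_norm_of_ne_zero hx)).congr_of_eventuallyEq
    hu).congr_fderiv ?_
  ext v
  simp
  ring

theorem pFlux_radial (p : ℝ) {u : EuclideanSpace ℝ (Fin N) → ℝ} {φ : ℝ → ℝ} {c : ℝ}
    {x : EuclideanSpace ℝ (Fin N)} (hx : x ≠ 0) (hφ : HasDerivAt φ c ‖x‖)
    (hu : u =ᶠ[𝓝 x] fun y => φ ‖y‖) : pFlux p u x = (signedPow p c / ‖x‖) • x := by
  have hn : ‖x‖ ≠ 0 := norm_ne_zero_iff.2 hx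
  rw [pFlux, (hasGradientAt_radial hx hφ hu).gradient, norm_smul, norm_div, norm_norm,
    div_mul_cancel₀ _ hn, smul_smul, signedPow, Real.norm_eq_abs, mul_div_assoc]

/-- The divergence of the radial field `h(|y|) y`. -/
theorem divergence_radial {F : EuclideanSpace ℝ (Fin N) → EuclideanSpace ℝ (Fin N)} {h : ℝ → ℝ}
    {h' : ℝ} {x : EuclideanSpace ℝ (Fin N)} (hx : x ≠ 0) (hh : HasDerivAt h h' ‖x‖)
    (hF : F =ᶠ[𝓝 x] fun y => h ‖y‖ • y) :
    DifferentiableAt ℝ F x ∧ divergence F x = N * h ‖x‖ + h' * ‖x‖ := by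
  have hn : ‖x‖ ≠ 0 := norm_ne_zero_iff.2 hx
  have hd := ((hh.comp_hasFDerivAt x (hasFDerivAt_norm_of_ne_zero hx)).smul
    (hasFDerivAt_id x)).congr_of_eventuallyEq hF
  refine ⟨hd.differentiableAt, ?_⟩
  have hsum : ∑ i : Fin N, x i * x i = ‖x‖ ^ 2 := by
    rw [EuclideanSpace.real_norm_sq_eq]
    exact Finset.sum_congr rfl fun i _ => (sq _).symm
  have hcoord : ∀ i : Fin N, (fderiv ℝ F x (EuclideanSpace.single i 1)) i =
      h ‖x‖ + h' / ‖x‖ * (x i * x i) := fun i => by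
    rw [hd.fderiv]
    simp [EuclideanSpace.inner_single_right]
    ring
  rw [divergence, Finset.sum_congr rfl fun i _ => hcoord i, Finset.sum_add_distrib,
    ← Finset.mul_sum, hsum, Finset.sum_const, Finset.card_univ, Fintype.card_fin, nsmul_eq_mul]
  field_simp

end

section

variable {n : ℕ} {p R R' lam : ℝ}

/-- The derivative of `t^n g(t)` is `s^n` times the divergence of the radial field `g(|x|) x / |x|`
in dimension `n + 1`. -/
theorem hasDerivAt_pow_mul {g : ℝ → ℝ} {g' s : ℝ} (hs : s ≠ 0) (hg : HasDerivAt g g' s) :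
    HasDerivAt (fun t => t ^ n * g t) (s ^ n * (g' + n * g s / s)) s := by
  refine ((hasDerivAt_pow n s).mul hg).congr_deriv ?_
  cases n with
  | zero => simp
  | succ m =>
    simp only [Nat.add_sub_cancel, pow_succ]
    field_simp
    ring

theorem isRadialEigenfunction_of_isDirichletEigenfunction (hR : 0 < R) {φ : ℝ → ℝ}
    (h : IsDirichletEigenfunction p (fun s => s ^ n) (fun s => s ^ n) R R' lam φ) :
    IsRadialEigenfunction (n + 1) p R R' lam fun x => φ ‖x‖ := by
  have hne : ∀ x : EuclideanSpace ℝ (Fin (n + 1)), ‖x‖ ∈ Ioo R R' → x ≠ 0 := fun x hx =>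
    norm_pos_iff.1 (hR.trans hx.1)
  have hg : ∀ s ∈ Ioo R R', DifferentiableAt ℝ (fun t => signedPow p (deriv φ t)) s :=
    fun s hs => by
      have h1 := (h.differentiableAt_flux s hs).mul
        ((differentiableAt_pow n (x := s) (𝕜 := ℝ)).inv (pow_pos (hR.trans hs.1) n).ne')
      refine h1.congr_of_eventuallyEq ?_
      filter_upwards [lt_mem_nhds (hR.trans hs.1)] with t ht
      have := (pow_pos ht n).ne'
      simp only [Pi.mul_apply, Pi.inv_apply]
      field_simp
  have hflux : ∀ x : EuclideanSpace ℝ (Fin (n + 1)), ‖x‖ ∈ Ioo R R' →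
      pFlux p (fun x : EuclideanSpace ℝ (Fin (n + 1)) => φ ‖x‖) =ᶠ[𝓝 x]
        fun y => (signedPow p (deriv φ ‖y‖) / ‖y‖) • y := fun x hx => by
    filter_upwards [continuous_norm.continuousAt.preimage_mem_nhds (Ioo_mem_nhds hx.1 hx.2)]
      with y hy
    exact pFlux_radial p (hne y hy) (h.differentiableAt _ hy).hasDerivAt (EventuallyEq.refl _ _)
  have hdiv := fun (x : EuclideanSpace ℝ (Fin (n + 1))) (hx : ‖x‖ ∈ Ioo R R') =>
    divergence_radial (hne x hx) ((hg _ hx).hasDerivAt.div (hasDerivAt_id ‖x‖)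
      (hR.trans hx.1).ne') (hflux x hx)
  refine ⟨fun x y _ hxy => by simp only [hxy], ?_, fun x hx => ?_, fun x hx => (hdiv x hx).1,
    fun x hx => ?_, ?_, ?_⟩
  · exact h.continuousOn.comp continuous_norm.continuousOn fun x hx => hx
  · exact (h.differentiableAt _ hx).comp x (hasFDerivAt_norm_of_ne_zero (hne x hx)).differentiableAt
  · rw [(hdiv x hx).2]
    have hpos := hR.trans hx.1
    have h1 := h.equation _ hx
    rw [(hasDerivAt_pow_mul hpos.ne' (hg _ hx).hasDerivAt).deriv] at h1
    have h2 := (pow_pos hpos n).ne'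
    have h3 : deriv (fun t => signedPow p (deriv φ t)) ‖x‖ +
        n * signedPow p (deriv φ ‖x‖) / ‖x‖ + lam * signedPow p (φ ‖x‖) = 0 := by
      apply mul_left_cancel₀ h2
      linear_combination h1
    simp only [id, Pi.div_apply]
    push_cast
    field_simp
    field_simp at h3
    linear_combination -h3
  · rintro x (hx | hx)
    · simp only [hx, h.left_eq_zero]
    · simp only [hx, h.right_eq_zero]
  · obtain ⟨t, ht, hφ⟩ := h.nontrivial
    refine ⟨EuclideanSpace.single 0 t, ?_⟩
    have : ‖(EuclideanSpace.single 0 t : EuclideanSpace ℝ (Fin (n + 1)))‖ = t := by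
      simp [abs_of_pos (hR.trans ht.1)]
    rw [this]
    exact ⟨ht, hφ⟩

theorem IsRadialEigenfunction.isDirichletEigenfunction (hR : 0 < R) (hRR' : R < R')
    {u : EuclideanSpace ℝ (Fin (n + 1)) → ℝ} (h : IsRadialEigenfunction (n + 1) p R R' lam u) :
    IsDirichletEigenfunction p (fun s => s ^ n) (fun s => s ^ n) R R' lam
      fun s => u (s • EuclideanSpace.single 0 1) := by
  set e : EuclideanSpace ℝ (Fin (n + 1)) := EuclideanSpace.single 0 1 with he
  have hnorm : ∀ s, 0 < s → ‖s • e‖ = s := fun s hs => by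
    rw [norm_smul, he]
    simp [abs_of_pos hs]
  have hcont : Continuous fun s : ℝ => s • e := by fun_prop
  set φ : ℝ → ℝ := fun s => u (s • e) with hφdef
  have hφ : ∀ s ∈ Ioo R R', DifferentiableAt ℝ φ s := fun s hs => by
    have h1 : DifferentiableAt ℝ u (s • e) :=
      h.differentiableAt _ (by rwa [hnorm s (hR.trans hs.1)])
    exact h1.comp (f := fun s : ℝ => s • e) s (by fun_prop)
  have hrad : ∀ y : EuclideanSpace ℝ (Fin (n + 1)), ‖y‖ ∈ Icc R R' → u y = φ ‖y‖ := fun y hy =>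
    h.radial y _ hy (hnorm _ (hR.trans_le hy.1)).symm
  have hev : ∀ x : EuclideanSpace ℝ (Fin (n + 1)), ‖x‖ ∈ Ioo R R' →
      ∀ᶠ y in 𝓝 x, ‖y‖ ∈ Ioo R R' := fun x hx =>
    continuous_norm.continuousAt.preimage_mem_nhds (Ioo_mem_nhds hx.1 hx.2)
  have hne : ∀ x : EuclideanSpace ℝ (Fin (n + 1)), ‖x‖ ∈ Ioo R R' → x ≠ 0 := fun x hx =>
    norm_pos_iff.1 (hR.trans hx.1)
  have hflux : ∀ x : EuclideanSpace ℝ (Fin (n + 1)), ‖x‖ ∈ Ioo R R' →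
      pFlux p u x = (signedPow p (deriv φ ‖x‖) / ‖x‖) • x := fun x hx =>
    pFlux_radial p (hne x hx) (hφ _ hx).hasDerivAt
      ((hev x hx).mono fun y hy => hrad y (Ioo_subset_Icc_self hy))
  have hg : ∀ s ∈ Ioo R R', DifferentiableAt ℝ (fun t => signedPow p (deriv φ t)) s :=
    fun s hs => by
      have h1 : DifferentiableAt ℝ (pFlux p u) (s • e) :=
        h.differentiableAt_flux _ (by rwa [hnorm s (hR.trans hs.1)])
      have h2 : DifferentiableAt ℝ (fun t : ℝ => pFlux p u (t • e)) s :=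
        h1.comp (f := fun s : ℝ => s • e) s (by fun_prop)
      have h3 : DifferentiableAt ℝ (fun t : ℝ => (pFlux p u (t • e)) 0) s :=
        (EuclideanSpace.proj (𝕜 := ℝ) (0 : Fin (n + 1))).differentiableAt.comp s h2
      refine h3.congr_of_eventuallyEq ?_
      filter_upwards [Ioo_mem_nhds hs.1 hs.2] with t ht
      have ht0 := hR.trans ht.1
      rw [hflux _ (by rwa [hnorm t ht0]), hnorm t ht0]
      simp [he]
      field_simp
  have hder := fun (s : ℝ) (hs : s ∈ Ioo R R') =>
    hasDerivAt_pow_mul (n := n) (hR.trans hs.1).ne' (hg s hs).hasDerivAt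
  refine ⟨?_, hφ, fun s hs => (hder s hs).differentiableAt, fun s hs => ?_, ?_, ?_, ?_⟩
  · exact h.continuousOn.comp hcont.continuousOn fun s hs => by
      rwa [mem_ofPred_eq, hnorm s (hR.trans_le hs.1)]
  · rw [(hder s hs).deriv]
    have hpos := hR.trans hs.1
    have hmem : ‖s • e‖ ∈ Ioo R R' := by rwa [hnorm s hpos]
    have hdiv := (divergence_radial (hne _ hmem) ((hg _ hmem).hasDerivAt.div
      (hasDerivAt_id ‖s • e‖) (hR.trans hmem.1).ne')
      ((hev _ hmem).mono fun y hy => hflux y hy)).2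
    have heq := h.equation _ hmem
    rw [hdiv] at heq
    simp only [hnorm s hpos, id, Pi.div_apply] at heq
    push_cast at heq
    have h3 : deriv (fun t => signedPow p (deriv φ t)) s +
        n * signedPow p (deriv φ s) / s + lam * signedPow p (φ s) = 0 := by
      rw [hφdef] at heq ⊢
      field_simp at heq ⊢
      linear_combination -heq
    linear_combination s ^ n * h3
  · exact h.boundary _ (Or.inl (hnorm R hR))
  · exact h.boundary _ (Or.inr (hnorm R' (hR.trans hRR')))
  · obtain ⟨x, hx, hux⟩ := h.nontrivial
    exact ⟨‖x‖, hx, by rwa [← hrad x (Ioo_subset_Icc_self hx)]⟩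

/-- The radial eigenvalues on an annulus are those of the radial ordinary differential equation. -/
theorem radialEigenvalues_eq_radialODEEigenvalues {N : ℕ} (hN : N ≠ 0) (hR : 0 < R)
    (hRR' : R < R') : radialEigenvalues N p R R' = radialODEEigenvalues N p R R' := by
  obtain ⟨n, rfl⟩ := Nat.exists_eq_succ_of_ne_zero hN
  exact Subset.antisymm (fun lam ⟨u, hu⟩ => ⟨_, hu.isDirichletEigenfunction hR hRR'⟩)
    fun lam ⟨φ, hφ⟩ => ⟨_, isRadialEigenfunction_of_isDirichletEigenfunction hR hφ⟩

end

/-! ### Change of variables -/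

/-- A change of variables `s = τ t` transforms eigenfunctions into eigenfunctions,
provided that the coefficients match. -/
theorem IsDirichletEigenfunction.comp {p a b a' b' lam c : ℝ} {ρ w ρ' w' τ τ' u : ℝ → ℝ}
    (h : IsDirichletEigenfunction p ρ w a b lam u) (hab' : a' ≤ b')
    (hτc : ContinuousOn τ (Icc a' b')) (hτ : ∀ t ∈ Ioo a' b', HasDerivAt τ (τ' t) t)
    (hmaps : MapsTo τ (Ioo a' b') (Ioo a b)) (ha : τ a' = a) (hb : τ b' = b)
    (hρ : ∀ t ∈ Ioo a' b', ρ' t * signedPow p (τ' t) = c * ρ (τ t))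
    (hw : ∀ t ∈ Ioo a' b', w' t = c * τ' t * w (τ t)) :
    IsDirichletEigenfunction p ρ' w' a' b' lam (u ∘ τ) := by
  have hu' : ∀ t ∈ Ioo a' b', HasDerivAt (u ∘ τ) (deriv u (τ t) * τ' t) t := fun t ht =>
    (h.differentiableAt _ (hmaps ht)).hasDerivAt.comp t (hτ t ht)
  have hflux : ∀ t ∈ Ioo a' b', HasDerivAt (fun s => ρ' s * signedPow p (deriv (u ∘ τ) s))
      (c * (deriv (fun s => ρ s * signedPow p (deriv u s)) (τ t) * τ' t)) t := fun t ht => by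
    have h1 := ((h.differentiableAt_flux _ (hmaps ht)).hasDerivAt.comp t (hτ t ht)).const_mul c
    refine h1.congr_of_eventuallyEq ?_
    filter_upwards [Ioo_mem_nhds ht.1 ht.2] with s hs
    rw [(hu' s hs).deriv, signedPow_mul]
    simp only [Function.comp]
    linear_combination signedPow p (deriv u (τ s)) * hρ s hs
  refine ⟨?_, fun t ht => (hu' t ht).differentiableAt, fun t ht => (hflux t ht).differentiableAt,
    fun t ht => ?_, ?_, ?_, ?_⟩
  · refine h.continuousOn.comp hτc fun t ht => ?_
    obtain ⟨s, hs, -⟩ := h.nontrivial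
    have hab := (hs.1.trans hs.2).le
    rcases eq_endpoints_or_mem_Ioo_of_mem_Icc ht with rfl | rfl | ht
    · rw [ha]
      exact left_mem_Icc.2 hab
    · rw [hb]
      exact right_mem_Icc.2 hab
    · exact Ioo_subset_Icc_self (hmaps ht)
  · rw [(hflux t ht).deriv, hw t ht]
    have := h.equation _ (hmaps ht)
    simp only [Function.comp]
    linear_combination c * τ' t * this
  · simp [ha, h.left_eq_zero]
  · simp [hb, h.right_eq_zero]
  · obtain ⟨s, hs, hus⟩ := h.nontrivial
    rw [← ha, ← hb] at hs
    obtain ⟨t, ht, rfl⟩ := intermediate_value_Ioo hab' hτc hs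
    exact ⟨t, ht, hus⟩

/-! ### The weight for `p = r + 1`, `N = 2 r + 1`, `R' = R + 1` -/

section

variable {r : ℕ} {R : ℝ}

theorem weight_eq (hr : 1 ≤ r) (R t : ℝ) :
    weight (2 * r + 1) (r + 1) R (R + 1) t =
      (R ^ 2 + R) ^ (r + 1) / (R + 1 - t) ^ (2 * (r + 1)) := by
  have hr0 : (r : ℝ) ≠ 0 := by positivity
  have e1 : ((2 * r + 1 : ℕ) : ℝ) - (r + 1) = r := by push_cast; ring
  have e2 : ((r : ℝ) + 1) - 1 = r := by ring
  have e3 : (r : ℝ) * (r + 1) / r = (r + 1 : ℕ) := by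
    push_cast
    field_simp
  have e4 : ((r : ℝ) + 1) * (((2 * r + 1 : ℕ) : ℝ) - 1) / r = (2 * (r + 1) : ℕ) := by
    push_cast
    field_simp
    ring
  have e5 : R + 1 - R = 1 := by ring
  rw [weight, coeffA, coeffB, e1, e2, e3, e4, div_self hr0, Real.one_rpow, Real.rpow_one,
    Real.rpow_one, Real.rpow_one, e5, div_one, div_one, one_mul, Real.rpow_natCast,
    Real.rpow_natCast]
  ring

/-- The weight extended by constants outside `[0, 1]`. -/
def extWeight (r : ℕ) (R t : ℝ) : ℝ :=
  (R ^ 2 + R) ^ (r + 1) / (R + 1 - projIcc (0 : ℝ) 1 zero_le_one t) ^ (2 * (r + 1))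

theorem extWeight_eq (hr : 1 ≤ r) (R : ℝ) {t : ℝ} (ht : t ∈ Icc (0 : ℝ) 1) :
    extWeight r R t = weight (2 * r + 1) (r + 1) R (R + 1) t := by
  rw [weight_eq hr, extWeight, projIcc_of_mem zero_le_one ht]

theorem continuous_extWeight (hR : 0 < R) : Continuous (extWeight r R) := by
  refine continuous_const.div (by fun_prop) fun t => ?_
  have := (projIcc (0 : ℝ) 1 zero_le_one t).2.2
  have : 0 < R + 1 - projIcc (0 : ℝ) 1 zero_le_one t := by linarith
  positivity

theorem extWeight_mem_Icc (hR : 0 < R) (t : ℝ) :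
    extWeight r R t ∈ Icc ((R / (R + 1)) ^ (r + 1)) (((R + 1) / R) ^ (r + 1)) := by
  obtain ⟨h0, h1⟩ := (projIcc (0 : ℝ) 1 zero_le_one t).2
  rw [extWeight]
  set y : ℝ := R + 1 - projIcc (0 : ℝ) 1 zero_le_one t with hy
  have hRy : R ≤ y := by linarith
  have hyR : y ≤ R + 1 := by linarith
  have hy0 : 0 < y := hR.trans_le hRy
  rw [pow_mul, ← div_pow]
  constructor
  · refine pow_le_pow_left₀ (by positivity) ?_ _
    rw [div_le_div_iff₀ (by positivity) (by positivity)]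
    have := mul_le_mul_of_nonneg_left (pow_le_pow_left₀ hy0.le hyR 2) hR.le
    linarith
  · refine pow_le_pow_left₀ (by positivity) ?_ _
    rw [div_le_div_iff₀ (by positivity) hR]
    have := mul_le_mul_of_nonneg_left (pow_le_pow_left₀ hR.le hRy 2) (by linarith : 0 ≤ R + 1)
    linarith

theorem div_add_one_pow_le_one (hR : 0 < R) (k : ℕ) : (R / (R + 1)) ^ k ≤ 1 :=
  pow_le_one₀ (by positivity) ((div_le_one (by positivity)).2 (by linarith))

theorem one_le_add_one_div_pow (hR : 0 < R) (k : ℕ) : 1 ≤ ((R + 1) / R) ^ k :=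
  one_le_pow₀ ((one_le_div hR).2 (by linarith))

theorem signedPow_natCast_add_one {x : ℝ} (hx : 0 < x) : signedPow (r + 1) x = x ^ r := by
  rw [signedPow_of_pos _ hx, add_sub_cancel_right, Real.rpow_natCast]

/-- The substitution `t = R + 1 - (R² + R) / s` identifies the radial equation with the weighted
one. -/
theorem radialODEEigenvalues_eq_weightedEigenvalues (hr : 1 ≤ r) (hR : 0 < R) :
    radialODEEigenvalues (2 * r + 1) (r + 1) R (R + 1) =
      weightedEigenvalues (r + 1) (weight (2 * r + 1) (r + 1) R (R + 1)) := by
  have hA : 0 < R ^ 2 + R := by positivity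
  rw [radialODEEigenvalues, weightedEigenvalues]
  simp only [Nat.add_sub_cancel]
  refine Subset.antisymm ?_ ?_
  · rintro lam ⟨u, hu⟩
    have hpos : ∀ t ∈ Icc (0 : ℝ) 1, 0 < R + 1 - t := fun t ht => by linarith [ht.2]
    have hder : ∀ t ∈ Icc (0 : ℝ) 1, HasDerivAt (fun t => (R ^ 2 + R) / (R + 1 - t))
        ((R ^ 2 + R) / (R + 1 - t) ^ 2) t := fun t ht => by
      refine ((hasDerivAt_const t (R ^ 2 + R)).fun_div ((hasDerivAt_id t).const_sub (R + 1))
        (hpos t ht).ne').congr_deriv ?_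
      simp
    refine ⟨_, hu.comp (c := ((R ^ 2 + R) ^ r)⁻¹) zero_le_one
      (fun t ht => (hder t ht).continuousAt.continuousWithinAt)
      (fun t ht => hder t (Ioo_subset_Icc_self ht)) (fun t ht => ?_) ?_ ?_ (fun t ht => ?_)
      fun t ht => ?_⟩
    · have := hpos t (Ioo_subset_Icc_self ht)
      constructor
      · rw [lt_div_iff₀ this]
        nlinarith [mul_pos hR ht.1]
      · rw [div_lt_iff₀ this]
        nlinarith [mul_pos (by linarith : 0 < R + 1) (sub_pos.2 ht.2)]
    · rw [sub_zero, div_eq_iff (by positivity)]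
      ring
    · rw [add_sub_cancel_right, div_eq_iff hR.ne']
      ring
    · have := hpos t (Ioo_subset_Icc_self ht)
      rw [signedPow_natCast_add_one (by positivity), div_pow, div_pow, ← pow_mul,
        pow_mul' (R ^ 2 + R)]
      field_simp
    · have := hpos t (Ioo_subset_Icc_self ht)
      rw [weight_eq hr, div_pow]
      field_simp
      ring
  · rintro lam ⟨v, hv⟩
    have hpos : ∀ s ∈ Icc R (R + 1), 0 < s := fun s hs => hR.trans_le hs.1
    have hder : ∀ s ∈ Icc R (R + 1), HasDerivAt (fun s => R + 1 - (R ^ 2 + R) / s)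
        ((R ^ 2 + R) / s ^ 2) s := fun s hs => by
      refine (((hasDerivAt_const s (R ^ 2 + R)).fun_div (hasDerivAt_id s)
        (hpos s hs).ne').const_sub (R + 1)).congr_deriv ?_
      simp
      ring
    have hmaps : MapsTo (fun s => R + 1 - (R ^ 2 + R) / s) (Ioo R (R + 1)) (Ioo 0 1) :=
      fun s hs => by
        have := hpos s (Ioo_subset_Icc_self hs)
        constructor
        · rw [sub_pos, div_lt_iff₀ this]
          nlinarith [mul_pos (by linarith : 0 < R + 1) (sub_pos.2 hs.1)]
        · rw [sub_lt_comm, lt_div_iff₀ this]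
          nlinarith [mul_pos hR (sub_pos.2 hs.2)]
    refine ⟨_, hv.comp (c := (R ^ 2 + R) ^ r) (by linarith)
      (fun s hs => (hder s hs).continuousAt.continuousWithinAt)
      (fun s hs => hder s (Ioo_subset_Icc_self hs)) hmaps ?_ ?_ (fun s hs => ?_)
      fun s hs => ?_⟩
    · field_simp
      ring
    · field_simp
      ring
    · have := hpos s (Ioo_subset_Icc_self hs)
      rw [signedPow_natCast_add_one (by positivity), div_pow, ← pow_mul]
      field_simp
    · have := hpos s (Ioo_subset_Icc_self hs)
      rw [weight_eq hr, sub_sub_cancel, div_pow]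
      field_simp
      ring

theorem tendsto_div_add_one : Tendsto (fun R : ℝ => R / (R + 1)) atTop (𝓝 1) := by
  have h : Tendsto (fun R : ℝ => 1 - (R + 1)⁻¹) atTop (𝓝 (1 - 0)) :=
    tendsto_const_nhds.sub
      (tendsto_inv_atTop_zero.comp (tendsto_atTop_add_const_right _ 1 tendsto_id))
  rw [sub_zero] at h
  refine h.congr' ?_
  filter_upwards [eventually_gt_atTop 0] with R hR
  field_simp
  ring

theorem tendsto_div_add_one_pow (k : ℕ) :
    Tendsto (fun R : ℝ => (R / (R + 1)) ^ k) atTop (𝓝 1) := by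
  simpa using tendsto_div_add_one.pow k

theorem tendsto_add_one_div_pow (k : ℕ) :
    Tendsto (fun R : ℝ => ((R + 1) / R) ^ k) atTop (𝓝 1) := by
  simpa [← inv_pow] using (tendsto_div_add_one_pow k).inv₀ one_ne_zero

theorem integral_mem_Icc {f : ℝ → ℝ} (hf : Continuous f) {a b : ℝ} (h : ∀ t, f t ∈ Icc a b) :
    ∫ t in (0 : ℝ)..1, f t ∈ Icc a b := by
  have h1 := intervalIntegral.integral_mono (μ := MeasureTheory.volume) zero_le_one
    (intervalIntegrable_const (c := a)) (hf.intervalIntegrable 0 1) fun t => (h t).1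
  have h2 := intervalIntegral.integral_mono (μ := MeasureTheory.volume) zero_le_one
    (hf.intervalIntegrable 0 1) (intervalIntegrable_const (c := b)) fun t => (h t).2
  simp only [intervalIntegral.integral_const, sub_zero, one_smul] at h1 h2
  exact ⟨h1, h2⟩

theorem tendsto_qPlus (hr : 1 ≤ r) :
    Tendsto (fun R : ℝ => qPlus (2 * r + 1) (r + 1) R (R + 1)) atTop (𝓝 1) := by
  have key : ∀ R : ℝ, 0 < R →
      qPlus (2 * r + 1) (r + 1) R (R + 1) ∈ Icc 1 (((R + 1) / R) ^ (r + 1)) := fun R hR => by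
    have e : qPlus (2 * r + 1) (r + 1) R (R + 1) = ∫ t in (0 : ℝ)..1, max 1 (extWeight r R t) :=
      intervalIntegral.integral_congr fun t ht => by
        rw [uIcc_of_le zero_le_one] at ht
        simp only [extWeight_eq hr R ht]
    rw [e]
    exact integral_mem_Icc (continuous_const.max (continuous_extWeight hR)) fun t =>
      ⟨le_max_left _ _, max_le (one_le_add_one_div_pow hR _) (extWeight_mem_Icc hR t).2⟩
  refine tendsto_of_tendsto_of_tendsto_of_le_of_le' tendsto_const_nhds
    (tendsto_add_one_div_pow (r + 1)) ?_ ?_ <;>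
    filter_upwards [eventually_gt_atTop 0] with R hR
  exacts [(key R hR).1, (key R hR).2]

theorem tendsto_qMinus (hr : 1 ≤ r) :
    Tendsto (fun R : ℝ => qMinus (2 * r + 1) (r + 1) R (R + 1)) atTop (𝓝 1) := by
  have key : ∀ R : ℝ, 0 < R →
      qMinus (2 * r + 1) (r + 1) R (R + 1) ∈ Icc ((R / (R + 1)) ^ (r + 1)) 1 := fun R hR => by
    have e : qMinus (2 * r + 1) (r + 1) R (R + 1) = ∫ t in (0 : ℝ)..1, min 1 (extWeight r R t) :=
      intervalIntegral.integral_congr fun t ht => by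
        rw [uIcc_of_le zero_le_one] at ht
        simp only [extWeight_eq hr R ht]
    rw [e]
    exact integral_mem_Icc (continuous_const.min (continuous_extWeight hR)) fun t =>
      ⟨le_min (div_add_one_pow_le_one hR _) (extWeight_mem_Icc hR t).1, min_le_left _ _⟩
  refine tendsto_of_tendsto_of_tendsto_of_le_of_le' (tendsto_div_add_one_pow (r + 1))
    tendsto_const_nhds ?_ ?_ <;>
    filter_upwards [eventually_gt_atTop 0] with R hR
  exacts [(key R hR).1, (key R hR).2]

/-- The eigenvalues on the annulus form an increasing sequence, whose `p`-th roots lie close to the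
multiples of `π_p`. -/
theorem exists_radialEigenvalues_eq_range (hr : 1 ≤ r) (hR : 0 < R) :
    ∃ μ : ℕ → ℝ, StrictMono (fun k => μ k ^ ((r : ℝ) + 1)) ∧
      (∀ k : ℕ, μ k ∈ Icc ((k + 1) * piP (r + 1) / ((R + 1) / R) ^ (r + 1))
        ((k + 1) * piP (r + 1) / (R / (R + 1)) ^ (r + 1))) ∧
      radialEigenvalues (2 * r + 1) (r + 1) R (R + 1) = range fun k => μ k ^ ((r : ℝ) + 1) := by
  have hc : ((r : ℝ) + 1).HolderConjugate (((r : ℝ) + 1).conjExponent) :=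
    Real.HolderConjugate.conjExponent (by
      have : (1 : ℝ) ≤ r := by exact_mod_cast hr
      linarith)
  have hm : 0 < (R / (R + 1)) ^ (r + 1) := by positivity
  obtain ⟨μ, hμ, hbd, hrange⟩ := exists_weightedEigenvalues_eq_range hc
    (continuous_extWeight (r := r) hR) hm (div_add_one_pow_le_one hR _)
    (one_le_add_one_div_pow hR _) (extWeight_mem_Icc hR)
  have hT : 0 < pruferTime ((r : ℝ) + 1) ((r : ℝ) + 1).conjExponent Real.pi := by
    have := strictMono_pruferTime hc Real.pi_pos
    rwa [pruferTime_zero] at this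
  have hμ0 : ∀ k, 0 < μ k := fun k =>
    lt_of_lt_of_le (div_pos (by positivity) (by positivity)) (hbd k).1
  rw [pruferTime_pi hc] at hbd
  refine ⟨μ, fun j k hjk => Real.rpow_lt_rpow (hμ0 j).le (hμ hjk) hc.pos, hbd, ?_⟩
  rw [radialEigenvalues_eq_radialODEEigenvalues (by omega) hR (by linarith),
    radialODEEigenvalues_eq_weightedEigenvalues hr hR, ← hrange]
  exact weightedEigenvalues_congr fun t ht => (extWeight_eq hr R (Ioo_subset_Icc_self ht)).symm

end

end RadialPLaplace

end

open RadialPLaplace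
theorem mainTheorem2 (r N : ℕ) (p : ℝ) (hr : 1 ≤ r) (hp : p = r + 1) (hN : N = 2 * r + 1) :
    -- the weight
    (∀ R : ℝ, 0 < R → ∀ t ∈ Icc (0 : ℝ) 1,
      weight N p R (R + 1) t = (R ^ 2 + R) ^ (r + 1) / (R + 1 - t) ^ (2 * (r + 1))) ∧
    -- its averages
    Tendsto (fun R : ℝ => qPlus N p R (R + 1)) atTop (𝓝 1) ∧
    Tendsto (fun R : ℝ => qMinus N p R (R + 1)) atTop (𝓝 1) ∧
    -- the three forms of the eigenvalue problem have the same eigenvalues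
    (∀ R : ℝ, 0 < R →
      radialEigenvalues N p R (R + 1) = radialODEEigenvalues N p R (R + 1) ∧
      radialODEEigenvalues N p R (R + 1) = weightedEigenvalues p (weight N p R (R + 1))) ∧
    -- the eigenvalues exist and converge
    (∀ k : ℕ, 1 ≤ k →
      (∀ R : ℝ, 0 < R → IsKthEigenvalue (radialEigenvalues N p R (R + 1)) k
        (kthEigenvalue (radialEigenvalues N p R (R + 1)) k)) ∧
      Tendsto (fun R : ℝ => kthEigenvalue (radialEigenvalues N p R (R + 1)) k) atTop
        (𝓝 ((k * piP p) ^ p))) := by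
  subst hp hN
  refine ⟨fun R _ t _ => weight_eq hr R t, tendsto_qPlus hr, tendsto_qMinus hr,
    fun R hR => ⟨radialEigenvalues_eq_radialODEEigenvalues (by omega) hR (by linarith),
      radialODEEigenvalues_eq_weightedEigenvalues hr hR⟩, fun k hk => ?_⟩
  obtain ⟨j, rfl⟩ := Nat.exists_eq_add_of_le' hk
  have key : ∀ R : ℝ, 0 < R → ∃ μ : ℝ,
      IsKthEigenvalue (radialEigenvalues (2 * r + 1) (r + 1) R (R + 1)) (j + 1)
        (μ ^ ((r : ℝ) + 1)) ∧
      μ ∈ Icc ((j + 1) * piP (r + 1) / ((R + 1) / R) ^ (r + 1))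
        ((j + 1) * piP (r + 1) / (R / (R + 1)) ^ (r + 1)) := fun R hR => by
    obtain ⟨μ, hμ, hbd, hrange⟩ := exists_radialEigenvalues_eq_range hr hR
    exact ⟨μ j, by rw [hrange]; exact isKthEigenvalue_range hμ j, hbd j⟩
  choose! μ hμ hbd using key
  refine ⟨fun R hR => by rw [(hμ R hR).kthEigenvalue_eq]; exact hμ R hR, ?_⟩
  have hlim : Tendsto μ atTop (𝓝 ((j + 1) * piP (r + 1))) := by
    have l1 := (tendsto_const_nhds (x := (j + 1) * piP (r + 1))).div
      (tendsto_add_one_div_pow (r + 1)) one_ne_zero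
    have l2 := (tendsto_const_nhds (x := (j + 1) * piP (r + 1))).div
      (tendsto_div_add_one_pow (r + 1)) one_ne_zero
    rw [div_one] at l1 l2
    refine tendsto_of_tendsto_of_tendsto_of_le_of_le' l1 l2 ?_ ?_ <;>
      filter_upwards [eventually_gt_atTop 0] with R hR
    exacts [(hbd R hR).1, (hbd R hR).2]
  push_cast
  refine (hlim.rpow_const (Or.inr (by positivity : (0 : ℝ) ≤ r + 1))).congr' ?_
  filter_upwards [eventually_gt_atTop 0] with R hR
  exact (hμ R hR).kthEigenvalue_eq.symm
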